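/- Let $E$ be a Euclidean space of dimension $n$, with $p_x$ denoting the orthogonal projection of $E$ onto the line $\mathbb{R}x$, and let $(e_1,\dots,e_n)$ and $(e'_1,\dots,e'_n)$ be two systems of $n$ linearly independent minimal vectors (nonzero vectors of smallest norm) of some lattice in $E$, such that $e'_j\neq\pm e_i$ for all $i,j$. Assume that there is a perfection relation $$\sum_{i=1}^n\lambda_i\,p_{e_i}=\sum_{i=1}^n\lambda'_i\,p_{e'_i}$$ with real coefficients $\lambda_i,\lambda'_i>0$. Let $\Lambda_0$ be the lattice generated by the $e_i$, and $\Lambda$ the lattice generated by all the $e_i$ and $e'_j$. If $\Lambda/\Lambda_0$ is cyclic of order $4$, then $n=7$ or $n=8$. More precisely, after renumbering the $e_i$ (together with the $\lambda_i$) and the $e'_i$ (together with the $\lambda'_i$), replacing some of the $e_i$ and $e'_i$ by their negatives, and multiplying all $\lambda_i$ and $\lambda'_i$ by a common positive factor, we have $\Lambda=\Lambda_0+\mathbb{Z}e$ with $$e=\frac{e_1+\dots+e_{m_1}+2(e_{m_1+1}+\dots+e_{m_1+m_2})}{4},\qquad m_1+m_2=n,$$ and the relation is one of the following three: 1. ($D_4$-glued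 relation) $n=7$, $(m_1,m_2)=(4,3)$, and, with $f=\frac{e_1+e_2+e_3+e_4}{2}$, $e'_1=e$, $e'_2=e-e_6-e_7$, $e'_3=e-e_5-e_7$, $e'_4=e-e_5-e_6$, $e'_5=f-e_3-e_4$, $e'_6=f-e_2-e_4$, $e'_7=f-e_2-e_3$; the relation is $\sum_{i=1}^7p_{e_i}=\sum_{i=1}^7p_{e'_i}$. 2. (Watson relation) $n=7$, $(m_1,m_2)=(6,1)$, $e'_j=e-e_j$ for all $j$, and the relation is $p_{e_1}+\dots+p_{e_6}+2p_{e_7}=p_{e'_1}+\dots+p_{e'_6}+2p_{e'_7}$. 3. (Watson relation) $n=8$, $(m_1,m_2)=(8,0)$, $e'_j=e-e_j$ for all $j$, and the relation is $\sum_{i=1}^8p_{e_i}=\sum_{i=1}^8p_{e'_i}$. -/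

import Mathlib

noncomputable section

/-- `x` is a minimal vector of the lattice `L`: a nonzero vector of `L` of smallest norm. -/
def IsMinimalVector {E : Type*} [NormedAddCommGroup E] (L : Submodule ℤ E) (x : E) : Prop :=
  x ∈ L ∧ x ≠ 0 ∧ ∀ y ∈ L, y ≠ 0 → ‖x‖ ≤ ‖y‖

/-- The orthogonal projection of `E` onto the line spanned by `x`, as an endomorphism of `E`. -/
def lineProj {E : Type*} [NormedAddCommGroup E] [InnerProductSpace ℝ E] (x : E) : E →L[ℝ] E :=
  (Submodule.span ℝ {x}).starProjection

/-- A perfection relation `∑ lam i • p_{e i} = ∑ lam' i • p_{e' i}` between two independent systems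
of `n` vectors, with strictly positive coefficients. The two sides are the positive and the negative
part of one linear relation between projections to pairwise distinct lines, so no line occurs on
both sides. -/
structure IsPerfectionRelation {E : Type*} [NormedAddCommGroup E] [InnerProductSpace ℝ E] {n : ℕ}
    (e e' : Fin n → E) (lam lam' : Fin n → ℝ) : Prop where
  indep : LinearIndependent ℝ e
  indep' : LinearIndependent ℝ e'
  pos : ∀ i, 0 < lam i
  pos' : ∀ i, 0 < lam' i
  distinct : ∀ i j, Submodule.span ℝ {e i} ≠ Submodule.span ℝ {e' j}
  relation : ∑ i, lam i • lineProj (e i) = ∑ i, lam' i • lineProj (e' i)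

/-- The lattice generated by a system of vectors. -/
def latticeOf {E : Type*} [NormedAddCommGroup E] {n : ℕ} (e : Fin n → E) : Submodule ℤ E :=
  Submodule.span ℤ (Set.range e)

/-- The lattice generated by two systems of vectors together. -/
def latticeOfPair {E : Type*} [NormedAddCommGroup E] {n : ℕ} (e e' : Fin n → E) :
    Submodule ℤ E :=
  latticeOf e ⊔ latticeOf e'

/-- The weighted system `(f, mu)` is obtained from `(e, lam)` by a renumbering `σ`, by changing the
signs of some of the vectors, and by dividing all the coefficients by `c`. -/
def SameSystem {E : Type*} [NormedAddCommGroup E] {n k : ℕ} (c : ℝ)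
    (e : Fin n → E) (lam : Fin n → ℝ) (f : Fin k → E) (mu : Fin k → ℝ) : Prop :=
  ∃ σ : Fin k ≃ Fin n, ∀ i, (f i = e (σ i) ∨ f i = -e (σ i)) ∧ lam (σ i) = c * mu i

/-- The coefficients `1, …, 1, 2, …, 2`, with `m₁` ones followed by `m₂` twos. -/
def quarterCoeff (m₁ m₂ : ℕ) : Fin (m₁ + m₂) → ℝ :=
  Fin.append (fun _ : Fin m₁ => (1 : ℝ)) (fun _ : Fin m₂ => (2 : ℝ))

/-- The vector `(f₁ + ⋯ + f_{m₁} + 2 (f_{m₁+1} + ⋯ + f_{m₁+m₂})) / 4`. -/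
def quarterVector {E : Type*} [NormedAddCommGroup E] [InnerProductSpace ℝ E] {m₁ m₂ : ℕ}
    (f : Fin (m₁ + m₂) → E) : E :=
  (1 / 4 : ℝ) • ∑ i, quarterCoeff m₁ m₂ i • f i

/-- The system `g - f_j` of Watson's relation, where `g = quarterVector f`. -/
def watsonSystem {E : Type*} [NormedAddCommGroup E] [InnerProductSpace ℝ E] {m₁ m₂ : ℕ}
    (f : Fin (m₁ + m₂) → E) : Fin (m₁ + m₂) → E :=
  fun j => quarterVector f - f j

/-- The second system of the relation obtained by gluing two `D₄`-relations: with
`g = (f₁ + f₂ + f₃ + f₄ + 2 (f₅ + f₆ + f₇)) / 4` and `h = (f₁ + f₂ + f₃ + f₄) / 2`, it consists of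
`g`, `g - f₆ - f₇`, `g - f₅ - f₇`, `g - f₅ - f₆`, `h - f₃ - f₄`, `h - f₂ - f₄`, `h - f₂ - f₃`
(in the code the indices start from `0`). -/
def gluedSystem {E : Type*} [NormedAddCommGroup E] [InnerProductSpace ℝ E]
    (f : Fin (4 + 3) → E) : Fin (4 + 3) → E :=
  let g : E := quarterVector f
  let h : E := (1 / 2 : ℝ) • (f 0 + f 1 + f 2 + f 3)
  ![g, g - f 5 - f 6, g - f 4 - f 6, g - f 4 - f 5, h - f 2 - f 3, h - f 1 - f 3, h - f 1 - f 2]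

/-- Up to numbering, signs, and a common positive factor, the relation is
`∑ p_{f_i} = ∑ p_{f'_i}`, where `f'` is the glued system of `f`, and the lattice generated by the two
systems is generated by the first one and `quarterVector f`. -/
def IsGluedRelation {E : Type*} [NormedAddCommGroup E] [InnerProductSpace ℝ E] {n : ℕ}
    (e e' : Fin n → E) (lam lam' : Fin n → ℝ) : Prop :=
  ∃ (f : Fin (4 + 3) → E) (c : ℝ), 0 < c ∧
    SameSystem c e lam f (fun _ => 1) ∧
    SameSystem c e' lam' (gluedSystem f) (fun _ => 1) ∧
    latticeOfPair e e' = latticeOf e ⊔ Submodule.span ℤ {quarterVector f}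

/-- Up to numbering, signs, and a common positive factor, the relation is Watson's relation
`∑ a_i p_{f_i} = ∑ a_i p_{g - f_i}` for `g = (∑ a_i f_i) / 4`, where `m₁` of the coefficients `a_i`
are equal to `1` and `m₂` are equal to `2`, and the lattice generated by the two systems is generated
by the first one and `g`. -/
def IsWatsonRelation {E : Type*} [NormedAddCommGroup E] [InnerProductSpace ℝ E] {n : ℕ}
    (m₁ m₂ : ℕ) (e e' : Fin n → E) (lam lam' : Fin n → ℝ) : Prop :=
  ∃ (f : Fin (m₁ + m₂) → E) (c : ℝ), 0 < c ∧
    SameSystem c e lam f (quarterCoeff m₁ m₂) ∧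
    SameSystem c e' lam' (watsonSystem f) (quarterCoeff m₁ m₂) ∧
    latticeOfPair e e' = latticeOf e ⊔ Submodule.span ℤ {quarterVector f}

end

/-!
Let `X` be the matrix of the coordinates of the `e'_j` with respect to the `e_i`. All these vectors have
the same norm, so the perfection relation says that `Xᵀ diag(lam') X = diag(lam)`, and comparing traces,
that `∑ lam = ∑ lam'` (`sum_mul_coord_eq`, `sum_eq_of_coord`). Consequently, for the weights `lam'`, every
quadratic form `q` with `q(e_i) = 1` for all `i` has mean `1` over the `e'_j`, whatever its coefficients
off the diagonal (`IsQuarterRelation.sum_mul_quadratic`). If such a form is at least `1` on all the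
vectors that `e'_j` could be, then it is equal to `1` on the `e'_j`.

After a choice of signs, the quotient is generated by `w = (1/4) ∑ r_i e_i` with `r_i ∈ {0, 1, 2}`, and the
rows of `Z = 4 X` are integral and congruent to `r`, `2 r` or `0` modulo `4`
(`exists_isQuarterRelation`). Let `m₁` and `m₂` be the numbers of coefficients `1` and `2`. Watson's
identity gives `4 ≤ m₁` and `8 ≤ m₁ + 2 m₂`, and its cases of equality exclude `(4, 2)`
(`quarter_types`). With the forms `∑ x_i² + t ∑_{i ≠ k} x_i x_k`, where the second sum is over the
coefficients `1` and `t` is `1/6` in general, `1/5` for `(6, 1)` and `0` for `m₁ = 4`, only `(8, 0)`, `(6, 1)`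
and `(4, 3)` are left, and few rows for each of them (`IsQuarterRelation.eight_zero`,
`IsQuarterRelation.six_one`, `IsQuarterRelation.four_three`). No coefficient `r_i` is `0`, since the
corresponding column of `Z` would vanish; so `n = m₁ + m₂`.

The orthogonality relations then determine the rows and the weights. In the first two cases those
between columns show that every type of row occurs exactly once (`IsQuarterRelation.watson_eight`,
`IsQuarterRelation.watson_six_one`). For `(4, 3)`, the dual relations `Z diag(lam)⁻¹ Zᵀ = diag(16 / lam')`
between rows leave the glued system as the only set of seven rows
(`IsQuarterRelation.glued_four_three`).
-/

/-! ### Cyclic quotients of order four -/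

section Quotient

variable {M : Type*} [AddCommGroup M] {A B : Submodule ℤ M}

theorem exists_two_smul_notMem (hcyc : IsAddCyclic (A ⧸ B.submoduleOf A))
    (hcard : Nat.card (A ⧸ B.submoduleOf A) = 4) : ∃ x ∈ A, (2 : ℤ) • x ∉ B := by
  obtain ⟨q, hq⟩ := hcyc.exists_generator
  obtain ⟨x, rfl⟩ := Submodule.Quotient.mk_surjective _ q
  refine ⟨x, x.2, fun h => ?_⟩
  have h4 : addOrderOf (Submodule.Quotient.mk x : A ⧸ B.submoduleOf A) = 4 := by
    rw [← hcard]
    exact addOrderOf_eq_card_of_forall_mem_zmultiples hq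
  have h2 : 2 • (Submodule.Quotient.mk x : A ⧸ B.submoduleOf A) = 0 := by
    rw [← Submodule.Quotient.mk_smul, Submodule.Quotient.mk_eq_zero,
      Submodule.submoduleOf, Submodule.mem_comap]
    simpa [← natCast_zsmul] using h
  have := addOrderOf_dvd_of_nsmul_eq_zero h2
  rw [h4] at this
  omega

theorem four_smul_mem (hcard : Nat.card (A ⧸ B.submoduleOf A) = 4) {x : M} (hx : x ∈ A) :
    (4 : ℤ) • x ∈ B := by
  have h : 4 • (Submodule.Quotient.mk ⟨x, hx⟩ : A ⧸ B.submoduleOf A) = 0 := by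
    rw [← hcard]
    exact card_nsmul_eq_zero'
  rw [← Submodule.Quotient.mk_smul, Submodule.Quotient.mk_eq_zero,
      Submodule.submoduleOf, Submodule.mem_comap] at h
  simpa [← natCast_zsmul] using h

/-- In a group of order `4`, an element whose double is nonzero is a generator. -/
theorem exists_sub_smul_mem (hcard : Nat.card (A ⧸ B.submoduleOf A) = 4) {x y : M} (hx : x ∈ A)
    (h2 : (2 : ℤ) • x ∉ B)
    (hy : y ∈ A) : ∃ k : ℤ, y - k • x ∈ B := by
  set q : A ⧸ B.submoduleOf A := Submodule.Quotient.mk ⟨x, hx⟩ with hq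
  have : Finite (A ⧸ B.submoduleOf A) := Nat.finite_of_card_ne_zero (by omega)
  have hdvd : addOrderOf q ∣ 2 ^ 2 := by
    have := addOrderOf_dvd_natCard q
    rwa [hcard] at this
  have hne : ¬ addOrderOf q ∣ 2 := by
    intro h
    rw [addOrderOf_dvd_iff_nsmul_eq_zero, hq, ← Submodule.Quotient.mk_smul,
      Submodule.Quotient.mk_eq_zero,
      Submodule.submoduleOf, Submodule.mem_comap] at h
    exact h2 (by simpa [← natCast_zsmul] using h)
  have h4 : addOrderOf q = 4 := by
    obtain ⟨k, hk, hk'⟩ := (Nat.dvd_prime_pow Nat.prime_two).1 hdvd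
    interval_cases k
    · exact absurd (by rw [hk']; norm_num) hne
    · exact absurd (by rw [hk']; norm_num) hne
    · simpa using hk'
  have htop : AddSubgroup.zmultiples q = ⊤ := by
    apply AddSubgroup.eq_top_of_card_eq
    rw [Nat.card_zmultiples, h4, hcard]
  have hmem : (Submodule.Quotient.mk ⟨y, hy⟩ : A ⧸ B.submoduleOf A) ∈
      AddSubgroup.zmultiples q := by rw [htop]; trivial
  obtain ⟨k, hk⟩ := AddSubgroup.mem_zmultiples_iff.1 hmem
  refine ⟨k, ?_⟩
  rw [hq, ← Submodule.Quotient.mk_smul, eq_comm, Submodule.Quotient.eq,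
    Submodule.submoduleOf, Submodule.mem_comap] at hk
  simpa using hk

end Quotient

theorem mem_latticeOf_iff {E : Type*} [NormedAddCommGroup E] {n : ℕ} {e : Fin n → E} {x : E} :
    x ∈ latticeOf e ↔ ∃ z : Fin n → ℤ, ∑ i, z i • e i = x :=
  Submodule.mem_span_range_iff_exists_fun ℤ

/-! ### Watson's inequality -/

section Watson

variable {E : Type*} [NormedAddCommGroup E] [InnerProductSpace ℝ E] {ι : Type*} [Fintype ι]

/-- Watson's identity. -/
theorem sum_mul_norm_sub_sq {f : ι → E} {ρ : ℝ} (hf : ∀ i, ‖f i‖ = ρ) {a : ι → ℝ} {d : ℝ} {g : E}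
    (hg : d • g = ∑ i, a i • f i) :
    ∑ i, a i * (‖g - f i‖ ^ 2 - ρ ^ 2) = (∑ i, a i - 2 * d) * ‖g‖ ^ 2 := by
  have h1 : ∀ i, a i * (‖g - f i‖ ^ 2 - ρ ^ 2) = a i * ‖g‖ ^ 2 - 2 * inner ℝ g (a i • f i) := by
    intro i
    rw [norm_sub_sq_real, hf, inner_smul_right]
    ring
  simp_rw [h1]
  rw [Finset.sum_sub_distrib, ← Finset.sum_mul, ← Finset.mul_sum, ← inner_sum, ← hg,
    inner_smul_right, real_inner_self_eq_norm_sq]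
  ring

variable {f : ι → E} {ρ : ℝ} {a : ι → ℝ} {d : ℝ} {g : E}

theorem two_mul_le_sum (hρ : 0 < ρ) (hf : ∀ i, ‖f i‖ = ρ) (ha : ∀ i, 0 ≤ a i)
    (hg : d • g = ∑ i, a i • f i) (hg0 : g ≠ 0) (hmin : ∀ i, a i ≠ 0 → ρ ≤ ‖g - f i‖) :
    2 * d ≤ ∑ i, a i := by
  have h := sum_mul_norm_sub_sq hf hg
  have h0 : 0 ≤ ∑ i, a i * (‖g - f i‖ ^ 2 - ρ ^ 2) := by
    refine Finset.sum_nonneg fun i _ => ?_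
    by_cases hi : a i = 0
    · simp [hi]
    · exact mul_nonneg (ha i) (sub_nonneg.2 (pow_le_pow_left₀ hρ.le (hmin i hi) 2))
  rw [h] at h0
  have hgpos : 0 < ‖g‖ ^ 2 := by positivity
  nlinarith [nonneg_of_mul_nonneg_left h0 hgpos]

/-- The case of equality in Watson's inequality. -/
theorem norm_sub_eq_of_sum_eq (hρ : 0 < ρ) (hf : ∀ i, ‖f i‖ = ρ) (ha : ∀ i, 0 ≤ a i)
    (hg : d • g = ∑ i, a i • f i) (hmin : ∀ i, a i ≠ 0 → ρ ≤ ‖g - f i‖)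
    (hsum : ∑ i, a i = 2 * d) {i : ι} (hi : a i ≠ 0) : ‖g - f i‖ = ρ := by
  have h := sum_mul_norm_sub_sq hf hg
  rw [hsum, sub_self, zero_mul, Finset.sum_eq_zero_iff_of_nonneg] at h
  · have h1 := (mul_eq_zero.1 (h i (Finset.mem_univ i))).resolve_left hi
    exact (pow_left_inj₀ (norm_nonneg _) hρ.le two_ne_zero).1 (sub_eq_zero.1 h1)
  · intro i _
    by_cases hi : a i = 0
    · simp [hi]
    · exact mul_nonneg (ha i) (sub_nonneg.2 (pow_le_pow_left₀ hρ.le (hmin i hi) 2))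

end Watson

/-! ### The possible quarter vectors -/

section QuarterTypes

variable {E : Type*} [NormedAddCommGroup E] [InnerProductSpace ℝ E] {ι : Type*} [Fintype ι]

theorem LinearIndependent.sum_smul_ne_zero {f : ι → E} (hf : LinearIndependent ℝ f) {x : ι → ℝ}
    {i : ι} (hi : x i ≠ 0) : ∑ k, x k • f k ≠ 0 := fun h =>
  hi (Fintype.linearIndependent_iff.1 hf x h i)

variable [DecidableEq ι]

/-- If `(1/2) ∑_{i ∈ s} f_i` belongs to a lattice having the independent vectors `f_i` among its
minimal vectors, then `4 ≤ #s`; when `#s = 4`, this vector is itself minimal. -/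
theorem four_le_card_of_half_sum_mem {L : Submodule ℤ E} {f : ι → E} {ρ : ℝ}
    (hind : LinearIndependent ℝ f) (hρ : 0 < ρ) (hfL : ∀ i, f i ∈ L) (hf : ∀ i, ‖f i‖ = ρ)
    (hmin : ∀ y ∈ L, y ≠ 0 → ρ ≤ ‖y‖) {s : Finset ι} (hs : s.Nonempty) {h : E} (hL : h ∈ L)
    (hh : (2 : ℝ) • h = ∑ i ∈ s, f i) : 4 ≤ s.card ∧ (s.card = 4 → ‖h‖ = ρ) := by
  obtain ⟨p, hp⟩ := hs
  have key : ∀ (f : ι → E) (_ : LinearIndependent ℝ f) (_ : ∀ i, f i ∈ L)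
      (_ : ∀ i, ‖f i‖ = ρ) (h : E) (_ : h ∈ L) (_ : (2 : ℝ) • h = ∑ i ∈ s, f i),
      4 ≤ s.card ∧ (s.card = 4 → ‖h - f p‖ = ρ) := by
    intro f hind hfL hf h hL hh
    have hh' : (2 : ℝ) • h = ∑ i, (if i ∈ s then (1 : ℝ) else 0) • f i := by
      rw [hh]; simp [ite_smul]
    have hsum : ∑ i, (if i ∈ s then (1 : ℝ) else 0) = s.card := by simp
    have hnonneg : ∀ i, 0 ≤ (if i ∈ s then (1 : ℝ) else 0) := fun i => by split_ifs <;> norm_num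
    have hh2 : h = ∑ i, (if i ∈ s then (1 / 2 : ℝ) else 0) • f i := by
      have : h = (1 / 2 : ℝ) • (2 : ℝ) • h := by rw [smul_smul]; norm_num
      rw [this, hh', Finset.smul_sum]
      refine Finset.sum_congr rfl fun i _ => ?_
      rw [smul_smul]; split_ifs <;> norm_num
    have hsub : ∀ i, ρ ≤ ‖h - f i‖ := by
      intro i
      refine hmin _ (L.sub_mem hL (hfL i)) ?_
      have : h - f i = ∑ k, ((if k ∈ s then (1 / 2 : ℝ) else 0) - if k = i then 1 else 0) • f k := by
        simp_rw [sub_smul, Finset.sum_sub_distrib, ← hh2]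
        simp [ite_smul]
      rw [this]
      refine hind.sum_smul_ne_zero (i := p) ?_
      rw [if_pos hp]; split_ifs <;> norm_num
    have h0 : h ≠ 0 := by
      rw [hh2]
      refine hind.sum_smul_ne_zero (i := p) ?_
      rw [if_pos hp]; norm_num
    constructor
    · have := two_mul_le_sum hρ hf hnonneg hh' h0 fun i _ => hsub i
      rw [hsum] at this
      norm_num at this
      exact_mod_cast this
    · intro hcard
      refine norm_sub_eq_of_sum_eq hρ hf hnonneg hh' (fun i _ => hsub i) ?_ (by simp [hp])
      rw [hsum, hcard]; norm_num
  refine ⟨(key f hind hfL hf h hL hh).1, fun hcard => ?_⟩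
  -- Replacing `f p` by its negative turns `h` into `h - f p`.
  let f₁ : ι → E := fun i => if i = p then -f i else f i
  have hf₁ : f₁ = fun i => (if i = p then (-1 : ℝˣ) else 1) • f i := by
    funext i
    by_cases hi : i = p <;> simp [f₁, hi]
  have h1 := (key f₁ ?_ ?_ ?_ (h - f p) (L.sub_mem hL (hfL p)) ?_).2 hcard
  · simpa [f₁] using h1
  · rw [hf₁]
    exact hind.units_smul fun i => if i = p then (-1 : ℝˣ) else 1
  · intro i
    by_cases hi : i = p
    · simpa [f₁, hi] using hfL p
    · simpa [f₁, hi] using hfL i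
  · intro i
    by_cases hi : i = p
    · simpa [f₁, hi] using hf p
    · simpa [f₁, hi] using hf i
  · rw [smul_sub, hh, ← Finset.add_sum_erase s f hp, ← Finset.add_sum_erase s f₁ hp]
    have : ∑ i ∈ s.erase p, f₁ i = ∑ i ∈ s.erase p, f i :=
      Finset.sum_congr rfl fun i hi => by simp [f₁, Finset.ne_of_mem_erase hi]
    rw [this]
    simp only [f₁, if_true]
    module

/-- The restrictions on the numbers `m₁`, `m₂` of coefficients `1` and `2` in a lattice vector
`(1/4) ∑ r_i f_i`, where the `f_i` are independent minimal vectors. The first two come from Watson's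
inequality. If `(m₁, m₂) = (4, 2)`, then the half-sum of the first four vectors is minimal, so the
mean of the square norms of `w`, `w - f_p`, `w - f_q`, `w - f_p - f_q`, where `f_p` and `f_q` are the
last two vectors, is `3/4` of the square of the minimal norm. -/
theorem quarter_types {L : Submodule ℤ E} {f : ι → E} {ρ : ℝ}
    (hind : LinearIndependent ℝ f) (hρ : 0 < ρ) (hfL : ∀ i, f i ∈ L) (hf : ∀ i, ‖f i‖ = ρ)
    (hmin : ∀ y ∈ L, y ≠ 0 → ρ ≤ ‖y‖) {r : ι → ℤ} (hr : ∀ i, r i = 0 ∨ r i = 1 ∨ r i = 2)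
    (hr1 : ∃ i, r i = 1) {w : E} (hwL : w ∈ L) (hw : (4 : ℝ) • w = ∑ i, (r i : ℝ) • f i) :
    4 ≤ (Finset.univ.filter (r · = 1)).card ∧
    8 ≤ (Finset.univ.filter (r · = 1)).card + 2 * (Finset.univ.filter (r · = 2)).card ∧
    ¬ ((Finset.univ.filter (r · = 1)).card = 4 ∧ (Finset.univ.filter (r · = 2)).card = 2) := by
  obtain ⟨p, hp⟩ := hr1
  set s := Finset.univ.filter (r · = 1) with hs
  set t := Finset.univ.filter (r · = 2) with ht
  have hsplit : ∀ i, (r i : ℝ) = (if i ∈ s then 1 else 0) + 2 * (if i ∈ t then 1 else 0) := by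
    intro i
    rcases hr i with h | h | h <;> simp [hs, ht, h]
  have hw' : (4 : ℝ) • w = ∑ i ∈ s, f i + (2 : ℝ) • ∑ i ∈ t, f i := by
    rw [hw]
    simp_rw [hsplit, add_smul, mul_smul, Finset.sum_add_distrib, ← Finset.smul_sum]
    simp [ite_smul]
  have hw2 : w = ∑ i, ((r i : ℝ) / 4) • f i := by
    have : w = (1 / 4 : ℝ) • (4 : ℝ) • w := by rw [smul_smul]; norm_num
    rw [this, hw, Finset.smul_sum]
    refine Finset.sum_congr rfl fun i _ => ?_
    rw [smul_smul]; ring_nf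
  -- No integral combination of the `f_i` changes the coefficient of `f_p` in `w` into `0`.
  have hne : ∀ z : ι → ℤ, w - ∑ i, z i • f i ≠ 0 := by
    intro z
    have : w - ∑ i, z i • f i = ∑ i, ((r i : ℝ) / 4 - z i) • f i := by
      simp_rw [sub_smul, Finset.sum_sub_distrib, ← hw2, Int.cast_smul_eq_zsmul]
    rw [this]
    refine hind.sum_smul_ne_zero (i := p) fun h => ?_
    rw [hp] at h
    have h' : ((1 : ℤ) : ℝ) = ((4 * z p : ℤ) : ℝ) := by push_cast; linarith
    have := Int.cast_injective h'
    omega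
  have hge : ∀ z : ι → ℤ, ρ ≤ ‖w - ∑ i, z i • f i‖ := fun z =>
    hmin _ (L.sub_mem hwL (L.sum_mem fun i _ => L.smul_mem _ (hfL i))) (hne z)
  have hge1 : ∀ i, ρ ≤ ‖w - f i‖ := by
    intro i
    have := hge (Pi.single i 1)
    simpa [Pi.single_apply, ite_smul] using this
  have h8 : 8 ≤ s.card + 2 * t.card := by
    have h := two_mul_le_sum hρ hf (a := fun i => (r i : ℝ)) (d := 4) ?_ hw ?_ fun i _ => hge1 i
    · simp_rw [hsplit, Finset.sum_add_distrib, ← Finset.mul_sum] at h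
      simp only [Finset.sum_ite_mem, Finset.univ_inter, Finset.sum_const, nsmul_eq_mul,
        mul_one] at h
      norm_num at h
      exact_mod_cast h
    · intro i
      rcases hr i with h | h | h <;> simp [h]
    · have := hne 0
      simpa using this
  set h : E := (2 : ℤ) • w - ∑ i ∈ t, f i with hh
  have hhL : h ∈ L := L.sub_mem (L.smul_mem _ hwL) (L.sum_mem fun i _ => hfL i)
  have hh2 : (2 : ℝ) • h = ∑ i ∈ s, f i := by
    rw [hh, ← Int.cast_smul_eq_zsmul ℝ, smul_sub, smul_smul]
    norm_num
    rw [hw']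
    module
  obtain ⟨h4, h4'⟩ := four_le_card_of_half_sum_mem hind hρ hfL hf hmin
    (s := s) ⟨p, by simp [hs, hp]⟩ hhL hh2
  refine ⟨h4, h8, ?_⟩
  rintro ⟨hs4, ht2⟩
  have hnorm := h4' hs4
  obtain ⟨a, b, hab, htab⟩ := Finset.card_eq_two.1 ht2
  have hwab : w = (1 / 2 : ℝ) • (h + f a + f b) := by
    have : (2 : ℝ) • w = h + f a + f b := by
      rw [hh, htab, Finset.sum_pair hab, ← Int.cast_smul_eq_zsmul ℝ]
      push_cast
      abel
    rw [← this, smul_smul]; norm_num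
  have g0 : ρ ≤ ‖w‖ := by simpa using hge 0
  have ga := hge1 a
  have gb := hge1 b
  have gab : ρ ≤ ‖w - f a - f b‖ := by
    have := hge (Pi.single a 1 + Pi.single b 1)
    simpa [Pi.single_apply, ite_smul, add_smul, Finset.sum_add_distrib, sub_sub] using this
  have hsq : ‖w‖ ^ 2 + ‖w - f a‖ ^ 2 + ‖w - f b‖ ^ 2 + ‖w - f a - f b‖ ^ 2 =
      ‖h‖ ^ 2 + ‖f a‖ ^ 2 + ‖f b‖ ^ 2 := by
    have e1 : w - f a = (1 / 2 : ℝ) • (h - f a + f b) := by rw [hwab]; module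
    have e2 : w - f b = (1 / 2 : ℝ) • (h + f a - f b) := by rw [hwab]; module
    have e3 : w - f a - f b = (1 / 2 : ℝ) • (h - f a - f b) := by rw [hwab]; module
    rw [e3, e1, e2, hwab]
    simp_rw [← real_inner_self_eq_norm_sq]
    simp only [inner_add_left, inner_add_right, inner_sub_left, inner_sub_right,
      real_inner_smul_left, real_inner_smul_right]
    ring
  rw [hnorm, hf, hf] at hsq
  have := pow_le_pow_left₀ hρ.le g0 2
  have := pow_le_pow_left₀ hρ.le ga 2
  have := pow_le_pow_left₀ hρ.le gb 2
  have := pow_le_pow_left₀ hρ.le gab 2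
  have : 0 < ρ ^ 2 := by positivity
  linarith

end QuarterTypes

/-! ### Integral relations -/

section QuarterRelation

variable {ι κ : Type*} [Fintype ι] [Fintype κ]

/-- The integral form of a perfection relation of cyclic index `4`: `r` gives the coefficients of
`4 w`, where `w` generates the quotient, and the row `Z j` the coordinates of `4 e'_j`, all with
respect to the vectors `e_i` with suitable signs. The matrix `X = Z / 4` satisfies
`Xᵀ diag(lam') X = diag(lam)`, and every row is congruent to `r`, `2 r` or `0` modulo `4`. -/
structure IsQuarterRelation (r : ι → ℤ) (Z : κ → ι → ℤ) (lam : ι → ℝ) (lam' : κ → ℝ) : Prop where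
  coeff : ∀ i, r i = 0 ∨ r i = 1 ∨ r i = 2
  row : ∀ j, (∀ i, Z j i ≡ r i [ZMOD 4]) ∨ (∀ i, Z j i ≡ 2 * r i [ZMOD 4]) ∨ ∀ i, 4 ∣ Z j i
  exists_row : ∃ j, ∀ i, Z j i ≡ r i [ZMOD 4]
  pos : ∀ i, 0 < lam i
  pos' : ∀ j, 0 < lam' j
  orth : ∀ i k, i ≠ k → ∑ j, lam' j * (Z j i * Z j k) = 0
  diag : ∀ i, ∑ j, lam' j * (Z j i) ^ 2 = 16 * lam i
  sum_eq : ∑ i, lam i = ∑ j, lam' j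
  -- A row of integral coordinates comes neither from `0` nor from one of the `± e_i`.
  integral_row : ∀ j, (∀ i, 4 ∣ Z j i) → 32 ≤ ∑ i, Z j i ^ 2

variable {r : ι → ℤ} {Z : κ → ι → ℤ} {lam : ι → ℝ} {lam' : κ → ℝ}

namespace IsQuarterRelation

theorem exists_ne_zero (h : IsQuarterRelation r Z lam lam') (i : ι) : ∃ j, Z j i ≠ 0 := by
  by_contra! h0
  have := h.diag i
  simp only [h0] at this
  have := h.pos i
  simp at *
  linarith

/-- The columns being orthogonal for the weights `lam'`, the products `Z j i * Z j k` with `i ≠ k` do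
not contribute to the mean of a quadratic form over the rows. -/
theorem sum_mul_quadratic (h : IsQuarterRelation r Z lam lam') (s : Finset ι) (c : ℤ) :
    ∑ j, lam' j * ((c * ∑ i, Z j i ^ 2 + (∑ i ∈ s, Z j i) ^ 2 - ∑ i ∈ s, Z j i ^ 2 - 16 * c : ℤ) : ℝ)
      = 0 := by
  classical
  have h1 : ∑ j, lam' j * ∑ i, (Z j i : ℝ) ^ 2 = 16 * ∑ j, lam' j := by
    simp_rw [Finset.mul_sum]
    rw [Finset.sum_comm]
    simp_rw [h.diag]
    rw [← Finset.mul_sum, h.sum_eq, Finset.mul_sum]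
  have h2 : ∑ j, lam' j * (∑ i ∈ s, (Z j i : ℝ)) ^ 2 = ∑ j, lam' j * ∑ i ∈ s, (Z j i : ℝ) ^ 2 := by
    simp_rw [sq (∑ i ∈ s, _), Finset.sum_mul_sum, Finset.mul_sum]
    rw [Finset.sum_comm, Finset.sum_comm (s := Finset.univ) (t := s)]
    refine Finset.sum_congr rfl fun i hi => ?_
    rw [Finset.sum_comm, Finset.sum_eq_single_of_mem i hi]
    · simp_rw [sq]
    · intro k _ hk
      exact h.orth i k hk.symm
  push_cast
  have h3 : ∀ j, lam' j * (c * ∑ i, (Z j i : ℝ) ^ 2 + (∑ i ∈ s, (Z j i : ℝ)) ^ 2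
      - ∑ i ∈ s, (Z j i : ℝ) ^ 2 - 16 * c) = c * (lam' j * ∑ i, (Z j i : ℝ) ^ 2)
      + lam' j * (∑ i ∈ s, (Z j i : ℝ)) ^ 2 - lam' j * ∑ i ∈ s, (Z j i : ℝ) ^ 2
      - 16 * c * lam' j := fun j => by ring
  simp_rw [h3]
  rw [Finset.sum_sub_distrib, Finset.sum_sub_distrib, Finset.sum_add_distrib, ← Finset.mul_sum,
    ← Finset.mul_sum, h1, h2]
  ring

/-- A quadratic form whose mean over the rows is its minimum is constant on the rows. -/
theorem quadratic_eq (h : IsQuarterRelation r Z lam lam') (s : Finset ι) (c : ℤ)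
    (hle : ∀ j, 16 * c ≤ c * ∑ i, Z j i ^ 2 + (∑ i ∈ s, Z j i) ^ 2 - ∑ i ∈ s, Z j i ^ 2) (j : κ) :
    c * ∑ i, Z j i ^ 2 + (∑ i ∈ s, Z j i) ^ 2 - ∑ i ∈ s, Z j i ^ 2 = 16 * c := by
  have h0 := h.sum_mul_quadratic s c
  rw [Finset.sum_eq_zero_iff_of_nonneg] at h0
  · have := (mul_eq_zero.1 (h0 j (Finset.mem_univ j))).resolve_left (h.pos' j).ne'
    have := Int.cast_eq_zero.1 this
    linarith
  · intro j _
    refine mul_nonneg (h.pos' j).le (Int.cast_nonneg ?_)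
    have := hle j
    linarith

end IsQuarterRelation

/-! ### Rows minimizing the quadratic forms -/

theorem Int.four_le_sq_of_modEq_two {z : ℤ} (hz : z ≡ 2 [ZMOD 4]) :
    4 ≤ z ^ 2 ∧ (z ^ 2 = 4 → z = 2 ∨ z = -2) := by
  have h : 2 ≤ |z| := by
    rcases abs_cases z with ⟨h, _⟩ | ⟨h, _⟩ <;> rw [h] <;> simp only [Int.ModEq] at hz <;> omega
  refine ⟨by nlinarith [sq_abs z], fun h4 => ?_⟩
  exact sq_eq_sq_iff_eq_or_eq_neg.1 (by rw [h4]; norm_num)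

/-- The numbers that enter the quadratic forms, for a row `z` congruent to `r`. Here `z = 1 - 4 k` on
the coefficients `1`, `K` is the sum of the integers `k`, and `Q` the sum of their squares; `R` is
the excess of the sum of the `z_i²` for the other coefficients over its least possible value. -/
theorem exists_row_invariants (hr : ∀ i, r i = 0 ∨ r i = 1 ∨ r i = 2) {z : ι → ℤ}
    (hz : ∀ i, z i ≡ r i [ZMOD 4]) : ∃ K Q R : ℤ, K ≤ Q ∧ 0 ≤ Q ∧ 0 ≤ R ∧
      ∑ i with r i = 1, z i = (Finset.univ.filter (r · = 1)).card - 4 * K ∧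
      ∑ i with r i = 1, z i ^ 2 = (Finset.univ.filter (r · = 1)).card - 8 * K + 16 * Q ∧
      ∑ i, z i ^ 2 = ∑ i with r i = 1, z i ^ 2 + 4 * (Finset.univ.filter (r · = 2)).card + R ∧
      (Q = 0 → ∀ i, r i = 1 → z i = 1) ∧
      (Q = 1 → K = 1 → ∃ p, r p = 1 ∧ z p = -3 ∧ ∀ i, r i = 1 → i ≠ p → z i = 1) ∧
      (R = 0 → (∀ i, r i = 2 → z i = 2 ∨ z i = -2) ∧ ∀ i, r i = 0 → z i = 0) := by
  classical
  have hk : ∀ i, ∃ k, z i = r i - 4 * k := fun i => by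
    obtain ⟨k, hk⟩ := (hz i).dvd
    exact ⟨k, by linarith⟩
  choose k hk using hk
  have hsplit : ∀ i, z i ^ 2 = (if r i = 1 then z i ^ 2 else 0) + (4 * (if r i = 2 then 1 else 0)
      + ((if r i = 2 then z i ^ 2 - 4 else 0) + if r i = 0 then z i ^ 2 else 0)) := by
    intro i
    rcases hr i with h | h | h <;> simp [h]
  have hR : ∀ i, 0 ≤ (if r i = 2 then z i ^ 2 - 4 else 0) + if r i = 0 then z i ^ 2 else 0 := by
    intro i
    have : r i = 2 → 4 ≤ z i ^ 2 := fun h2 => (Int.four_le_sq_of_modEq_two (h2 ▸ hz i)).1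
    split_ifs with h1 h2 h2
    · have := this h1; positivity
    · have := this h1; linarith
    · positivity
    · positivity
  have h1 : ∀ i ∈ Finset.univ.filter (r · = 1), z i = 1 - 4 * k i := fun i hi => by
    rw [hk i, (Finset.mem_filter.1 hi).2]
  refine ⟨∑ i with r i = 1, k i, ∑ i with r i = 1, k i ^ 2,
    ∑ i, ((if r i = 2 then z i ^ 2 - 4 else 0) + if r i = 0 then z i ^ 2 else 0),
    Finset.sum_le_sum fun i _ => by nlinarith [Int.le_self_sq (k i)],
    Finset.sum_nonneg fun i _ => sq_nonneg _, Finset.sum_nonneg fun i _ => hR i, ?_, ?_, ?_, ?_, ?_,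
    ?_⟩
  · rw [Finset.sum_congr rfl h1, Finset.sum_sub_distrib, ← Finset.mul_sum]
    simp
  · have h2 : ∀ i ∈ Finset.univ.filter (r · = 1), z i ^ 2 = 1 - 8 * k i + 16 * k i ^ 2 :=
      fun i hi => by rw [h1 i hi]; ring
    rw [Finset.sum_congr rfl h2, Finset.sum_add_distrib, Finset.sum_sub_distrib, ← Finset.mul_sum,
      ← Finset.mul_sum]
    simp
  · rw [Finset.sum_congr rfl fun i _ => hsplit i, Finset.sum_add_distrib, Finset.sum_add_distrib,
      ← Finset.mul_sum, Finset.sum_filter, add_assoc]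
    simp
  · intro hQ i hi
    rw [Finset.sum_eq_zero_iff_of_nonneg fun i _ => sq_nonneg _] at hQ
    have := pow_eq_zero_iff two_ne_zero |>.1 (hQ i (by simp [hi]))
    rw [hk, hi, this]; norm_num
  · intro hQ hK
    obtain ⟨p, hp, hp1⟩ : ∃ p ∈ Finset.univ.filter (r · = 1), 0 < k p := by
      by_contra! hcon
      have := Finset.sum_nonpos hcon
      omega
    have hle : ∀ i ∈ (Finset.univ.filter (r · = 1)).erase p, 0 ≤ k i ^ 2 := fun i _ => sq_nonneg _
    have hnn := Finset.sum_nonneg hle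
    rw [← Finset.add_sum_erase _ _ hp] at hQ
    have hp2 : k p = 1 := by nlinarith
    rw [hp2] at hQ
    have hQ' : ∑ i ∈ (Finset.univ.filter (r · = 1)).erase p, k i ^ 2 = 0 := by linarith
    rw [Finset.sum_eq_zero_iff_of_nonneg hle] at hQ'
    refine ⟨p, (Finset.mem_filter.1 hp).2, by rw [h1 p hp, hp2]; norm_num, fun i hi hip => ?_⟩
    have := pow_eq_zero_iff two_ne_zero |>.1 (hQ' i (by simp [hi, hip]))
    rw [hk, hi, this]; norm_num
  · intro h0
    rw [Finset.sum_eq_zero_iff_of_nonneg fun i _ => hR i] at h0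
    constructor
    · intro i hi
      have := h0 i (Finset.mem_univ i)
      simp only [hi, if_true] at this
      exact (Int.four_le_sq_of_modEq_two (hi ▸ hz i)).2 (by simpa [sub_eq_zero] using this)
    · intro i hi
      have := h0 i (Finset.mem_univ i)
      simpa [hi] using this

theorem sum_filter_sq_le (z : ι → ℤ) (p : ι → Prop) [DecidablePred p] :
    ∑ i with p i, z i ^ 2 ≤ ∑ i, z i ^ 2 :=
  Finset.sum_le_sum_of_subset_of_nonneg (Finset.filter_subset _ _) fun _ _ _ => sq_nonneg _

theorem four_mul_card_le_sum_sq {z : ι → ℤ} (hz : ∀ i, z i ≡ 2 * r i [ZMOD 4]) :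
    4 * ((Finset.univ.filter (r · = 1)).card : ℤ) ≤ ∑ i with r i = 1, z i ^ 2 := by
  have h : ∑ i with r i = 1, (4 : ℤ) ≤ ∑ i with r i = 1, z i ^ 2 := by
    refine Finset.sum_le_sum fun i hi => ?_
    have := hz i
    rw [(Finset.mem_filter.1 hi).2] at this
    exact (Int.four_le_sq_of_modEq_two this).1
  simpa [mul_comm] using h

namespace IsQuarterRelation

/-- Let `5 ≤ m₁`. Except for `(m₁, m₂) = (6, 1)`, the quadratic form `6 ∑ z_i² + (∑ z_i)² - ∑ z_i²`,
where the last two sums are over the coefficients `1`, takes values greater than its mean `96` on all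
rows, unless `(m₁, m₂) = (8, 0)`; then the value `96` characterizes the rows of Watson's relation. -/
theorem eight_zero (h : IsQuarterRelation r Z lam lam')
    (h5 : 5 ≤ (Finset.univ.filter (r · = 1)).card)
    (h8 : 8 ≤ (Finset.univ.filter (r · = 1)).card + 2 * (Finset.univ.filter (r · = 2)).card)
    (h61 : ¬ ((Finset.univ.filter (r · = 1)).card = 6 ∧ (Finset.univ.filter (r · = 2)).card = 1)) :
    (Finset.univ.filter (r · = 1)).card = 8 ∧ (Finset.univ.filter (r · = 2)).card = 0 ∧
    ∀ j, (∃ p, r p = 1 ∧ Z j p = -3 ∧ ∀ i, r i = 1 → i ≠ p → Z j i = 1) ∧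
      ∀ i, r i = 0 → Z j i = 0 := by
  set m₁ := (Finset.univ.filter (r · = 1)).card
  set m₂ := (Finset.univ.filter (r · = 2)).card
  -- The values on the rows that are not congruent to `r`.
  have hbig : ∀ j, ¬ (∀ i, Z j i ≡ r i [ZMOD 4]) → 96 < 6 * ∑ i, Z j i ^ 2 +
      (∑ i with r i = 1, Z j i) ^ 2 - ∑ i with r i = 1, Z j i ^ 2 := by
    intro j hj
    have hA := sum_filter_sq_le (Z j) (r · = 1)
    have hT := sq_nonneg (∑ i with r i = 1, Z j i)
    rcases h.row j with hj' | hj' | hj'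
    · exact absurd hj' hj
    · have := four_mul_card_le_sum_sq hj'
      have h5' : (5 : ℤ) ≤ m₁ := by exact_mod_cast h5
      linarith
    · have := h.integral_row j hj'
      linarith
  -- The values on the rows that are congruent to `r`, written with a square.
  have hodd : ∀ K Q R : ℤ, K ≤ Q → 0 ≤ R → 96 ≤ 5 * (m₁ - 8 * K + 16 * Q) + (m₁ - 4 * K) ^ 2 +
      24 * m₂ + 6 * R ∧ (5 * (m₁ - 8 * K + 16 * Q) + (m₁ - 4 * K) ^ 2 + 24 * m₂ + 6 * R = 96 →
        m₁ = 8 ∧ m₂ = 0 ∧ K = 1 ∧ Q = 1 ∧ R = 0) := by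
    intro K Q R hKQ hR
    have hid : 5 * (m₁ - 8 * K + 16 * Q) + (m₁ - 4 * K) ^ 2 + 24 * m₂ + 6 * R =
        (4 * K - m₁ + 5) ^ 2 + (15 * m₁ + 24 * m₂ - 25) + 80 * (Q - K) + 6 * R := by ring
    rw [hid]
    have hsq := sq_nonneg (4 * K - m₁ + 5)
    by_cases hm : m₁ = 8 ∧ m₂ = 0
    · rw [hm.1, hm.2]
      push_cast
      have h1 : 1 ≤ (4 * K - 8 + 5) ^ 2 := by
        have : 4 * K - 8 + 5 ≠ 0 := by omega
        have : 0 < (4 * K - 8 + 5) ^ 2 := by positivity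
        omega
      refine ⟨by linarith, fun heq => ?_⟩
      have h2 : (4 * K - 8 + 5) ^ 2 = 1 := by linarith
      have hK : K = 1 := by
        rcases sq_eq_sq_iff_eq_or_eq_neg.1 (h2.trans (one_pow 2).symm) with h3 | h3 <;> omega
      exact ⟨trivial, trivial, hK, by linarith, by linarith⟩
    · have : (121 : ℤ) < 15 * m₁ + 24 * m₂ := by
        have : 121 < 15 * m₁ + 24 * m₂ := by omega
        exact_mod_cast this
      exact ⟨by linarith, fun heq => by linarith⟩
  have hle : ∀ j, 16 * 6 ≤ 6 * ∑ i, Z j i ^ 2 +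
      (∑ i with r i = 1, Z j i) ^ 2 - ∑ i with r i = 1, Z j i ^ 2 := by
    intro j
    by_cases hj : ∀ i, Z j i ≡ r i [ZMOD 4]
    · obtain ⟨K, Q, R, hKQ, -, hR, hT, hA, hB, -⟩ := exists_row_invariants h.coeff hj
      have := (hodd K Q R hKQ hR).1
      rw [hB, hT, hA]
      linarith
    · have := hbig j hj
      linarith
  have heq := h.quadratic_eq _ 6 hle
  have hrow : ∀ j, m₁ = 8 ∧ m₂ = 0 ∧
      (∃ p, r p = 1 ∧ Z j p = -3 ∧ ∀ i, r i = 1 → i ≠ p → Z j i = 1) ∧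
      ∀ i, r i = 0 → Z j i = 0 := by
    intro j
    have hj : ∀ i, Z j i ≡ r i [ZMOD 4] := by
      by_contra hj
      have := hbig j hj
      have := heq j
      linarith
    obtain ⟨K, Q, R, hKQ, -, hR, hT, hA, hB, -, h1, h0⟩ := exists_row_invariants h.coeff hj
    have := heq j
    rw [hB, hT, hA] at this
    obtain ⟨e1, e2, e3, e4, e5⟩ := (hodd K Q R hKQ hR).2 (by linarith)
    exact ⟨e1, e2, h1 e4 e3, (h0 e5).2⟩
  obtain ⟨j, -⟩ := h.exists_row
  exact ⟨(hrow j).1, (hrow j).2.1, fun j => (hrow j).2.2⟩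

/-- For `(m₁, m₂) = (6, 1)`, the quadratic form to use is `5 ∑ z_i² + (∑ z_i)² - ∑ z_i²`, the last two
sums being over the six coefficients `1`. Its minimum `80` is attained by `r` and the rows obtained
from it by subtracting `4` in one of these six places, up to the sign of the remaining coordinate. -/
theorem six_one (h : IsQuarterRelation r Z lam lam')
    (h6 : (Finset.univ.filter (r · = 1)).card = 6) (h1 : (Finset.univ.filter (r · = 2)).card = 1)
    (j : κ) : ((∀ i, r i = 1 → Z j i = 1) ∨
      ∃ p, r p = 1 ∧ Z j p = -3 ∧ ∀ i, r i = 1 → i ≠ p → Z j i = 1) ∧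
      (∀ i, r i = 2 → Z j i = 2 ∨ Z j i = -2) ∧ ∀ i, r i = 0 → Z j i = 0 := by
  have hbig : ∀ j, ¬ (∀ i, Z j i ≡ r i [ZMOD 4]) → 80 < 5 * ∑ i, Z j i ^ 2 +
      (∑ i with r i = 1, Z j i) ^ 2 - ∑ i with r i = 1, Z j i ^ 2 := by
    intro j hj
    have hA := sum_filter_sq_le (Z j) (r · = 1)
    have hT := sq_nonneg (∑ i with r i = 1, Z j i)
    rcases h.row j with hj' | hj' | hj'
    · exact absurd hj' hj
    · have := four_mul_card_le_sum_sq hj'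
      rw [h6] at this
      push_cast at this
      linarith
    · have := h.integral_row j hj'
      linarith
  have hK : ∀ K : ℤ, 0 ≤ K * (K - 1) := fun K => by
    rcases le_or_gt K 0 with hK | hK <;> nlinarith
  have hle : ∀ j, 16 * 5 ≤ 5 * ∑ i, Z j i ^ 2 +
      (∑ i with r i = 1, Z j i) ^ 2 - ∑ i with r i = 1, Z j i ^ 2 := by
    intro j
    by_cases hj : ∀ i, Z j i ≡ r i [ZMOD 4]
    · obtain ⟨K, Q, R, hKQ, -, hR, hT, hA, hB, -⟩ := exists_row_invariants h.coeff hj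
      rw [hB, hT, hA, h6, h1]
      push_cast
      nlinarith [hK K]
    · have := hbig j hj
      linarith
  have heq := h.quadratic_eq _ 5 hle j
  have hj : ∀ i, Z j i ≡ r i [ZMOD 4] := by
    by_contra hj
    have := hbig j hj
    linarith
  obtain ⟨K, Q, R, hKQ, -, hR, hT, hA, hB, hrow0, hrow1, h0⟩ := exists_row_invariants h.coeff hj
  rw [hB, hT, hA, h6, h1] at heq
  push_cast at heq
  have hR0 : R = 0 := by nlinarith [hK K]
  have hQK : Q = K := by nlinarith [hK K]
  have hK0 : K * (K - 1) = 0 := by nlinarith [hK K]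
  refine ⟨?_, h0 hR0⟩
  rcases mul_eq_zero.1 hK0 with hK0 | hK0
  · exact Or.inl (hrow0 (by omega))
  · exact Or.inr (hrow1 (by omega) (by omega))

/-- If `m₁ = 4` and `3 ≤ m₂`, the form `∑ z_i²`, of mean `16`, is enough: the rows congruent to `2 r`
have square norm at least `16`, those congruent to `r` at least `4 + 4 m₂`. -/
theorem four_three (h : IsQuarterRelation r Z lam lam')
    (h4 : (Finset.univ.filter (r · = 1)).card = 4)
    (h3 : 3 ≤ (Finset.univ.filter (r · = 2)).card) :
    (Finset.univ.filter (r · = 2)).card = 3 ∧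
    ∀ j, ((∀ i, r i = 1 → Z j i = 1) ∧ (∀ i, r i = 2 → Z j i = 2 ∨ Z j i = -2) ∧
        ∀ i, r i = 0 → Z j i = 0) ∨
      ((∀ i, r i = 1 → Z j i = 2 ∨ Z j i = -2) ∧ ∀ i, r i ≠ 1 → Z j i = 0) := by
  set m₂ := (Finset.univ.filter (r · = 2)).card
  have h3' : (3 : ℤ) ≤ m₂ := by exact_mod_cast h3
  have hle : ∀ j, 16 * 1 ≤ 1 * ∑ i, Z j i ^ 2 + (∑ i ∈ (∅ : Finset ι), Z j i) ^ 2 -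
      ∑ i ∈ (∅ : Finset ι), Z j i ^ 2 := by
    intro j
    simp only [Finset.sum_empty]
    have hA := sum_filter_sq_le (Z j) (r · = 1)
    rcases h.row j with hj | hj | hj
    · obtain ⟨K, Q, R, hKQ, hQ, hR, hT, hA, hB, -⟩ := exists_row_invariants h.coeff hj
      rw [hB, hA, h4]
      push_cast
      linarith
    · have := four_mul_card_le_sum_sq hj
      rw [h4] at this
      push_cast at this
      linarith
    · have := h.integral_row j hj
      linarith
  have heq : ∀ j, ∑ i, Z j i ^ 2 = 16 := fun j => by
    have := h.quadratic_eq ∅ 1 hle j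
    simpa using this
  have hrow : ∀ j, (∀ i, Z j i ≡ r i [ZMOD 4]) → m₂ = 3 ∧ (∀ i, r i = 1 → Z j i = 1) ∧
      (∀ i, r i = 2 → Z j i = 2 ∨ Z j i = -2) ∧ ∀ i, r i = 0 → Z j i = 0 := by
    intro j hj
    obtain ⟨K, Q, R, hKQ, hQ, hR, hT, hA, hB, hrow0, -, h0⟩ := exists_row_invariants h.coeff hj
    have := heq j
    rw [hB, hA, h4] at this
    push_cast at this
    exact ⟨by omega, hrow0 (by omega), h0 (by omega)⟩
  obtain ⟨j₀, hj₀⟩ := h.exists_row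
  refine ⟨(hrow j₀ hj₀).1, fun j => ?_⟩
  rcases h.row j with hj | hj | hj
  · exact Or.inl (hrow j hj).2
  · right
    have hge : ∀ i, 0 ≤ Z j i ^ 2 - if r i = 1 then 4 else 0 := by
      intro i
      split_ifs with hi
      · have := hj i
        rw [hi] at this
        linarith [(Int.four_le_sq_of_modEq_two this).1]
      · simpa using sq_nonneg _
    have hsum : ∑ i, (Z j i ^ 2 - if r i = 1 then 4 else 0) = 0 := by
      rw [Finset.sum_sub_distrib, heq j, ← Finset.sum_filter, Finset.sum_const, h4]
      norm_num
    rw [Finset.sum_eq_zero_iff_of_nonneg fun i _ => hge i] at hsum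
    constructor
    · intro i hi
      have h1 := hj i
      rw [hi] at h1
      have h2 := hsum i (Finset.mem_univ i)
      rw [if_pos hi] at h2
      exact (Int.four_le_sq_of_modEq_two h1).2 (by linarith)
    · intro i hi
      have h2 := hsum i (Finset.mem_univ i)
      simpa [if_neg hi] using h2
  · have := h.integral_row j hj
    rw [heq j] at this
    norm_num at this

end IsQuarterRelation

end QuarterRelation

/-! ### The rows of the three relations -/

namespace IsQuarterRelation

variable {ι κ : Type*} [Fintype ι] [Fintype κ]
  {r : ι → ℤ} {Z : κ → ι → ℤ} {lam : ι → ℝ} {lam' : κ → ℝ}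

theorem reindex {ι' : Type*} [Fintype ι'] (h : IsQuarterRelation r Z lam lam') (σ : ι' ≃ ι) :
    IsQuarterRelation (fun i => r (σ i)) (fun j i => Z j (σ i)) (fun i => lam (σ i)) lam' where
  coeff i := h.coeff _
  row j := by simpa only [σ.surjective.forall] using h.row j
  exists_row := by simpa only [σ.surjective.forall] using h.exists_row
  pos i := h.pos _
  pos' := h.pos'
  orth i k hik := h.orth _ _ (σ.injective.ne hik)
  diag i := h.diag _
  sum_eq := by rw [← h.sum_eq, σ.sum_comp lam]
  integral_row j hj := by
    rw [σ.sum_comp fun i => Z j i ^ 2]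
    exact h.integral_row j (by simpa only [σ.surjective.forall] using hj)

/-- The vectors `e_i` of coefficient `2` may be replaced by their negatives, as `2` and `-2` are
congruent modulo `4`. -/
theorem signs (h : IsQuarterRelation r Z lam lam') {u : ι → ℤ} (hu : ∀ i, u i = 1 ∨ u i = -1)
    (hu1 : ∀ i, r i = 1 → u i = 1) : IsQuarterRelation r (fun j i => u i * Z j i) lam lam' := by
  have hsq : ∀ i, u i ^ 2 = 1 := fun i => by rcases hu i with h | h <;> rw [h] <;> norm_num
  have hdvd : ∀ j i, 4 ∣ u i * Z j i ↔ 4 ∣ Z j i := fun j i => by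
    rcases hu i with h | h <;> simp [h]
  have hmod : ∀ (c : ℤ) j i, Z j i ≡ c * r i [ZMOD 4] → u i * Z j i ≡ c * r i [ZMOD 4] := by
    intro c j i hji
    rcases hu i with hi | hi
    · simpa [hi] using hji
    · rcases h.coeff i with h0 | h0 | h0
      · simpa [h0, hi] using hji.neg
      · have := hu1 i h0
        omega
      · have h1 := hji.neg
        have h2 : -(c * r i) ≡ c * r i [ZMOD 4] := by
          rw [h0]
          exact Int.modEq_iff_dvd.2 ⟨c, by ring⟩
        simpa [hi] using h1.trans h2
  refine ⟨h.coeff, fun j => ?_, ?_, h.pos, h.pos', fun i k hik => ?_, fun i => ?_, h.sum_eq,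
    fun j hj => ?_⟩
  · rcases h.row j with hj | hj | hj
    · exact Or.inl fun i => by simpa using hmod 1 j i (by simpa using hj i)
    · exact Or.inr (Or.inl fun i => hmod 2 j i (hj i))
    · exact Or.inr (Or.inr fun i => (hdvd j i).2 (hj i))
  · obtain ⟨j, hj⟩ := h.exists_row
    exact ⟨j, fun i => by simpa using hmod 1 j i (by simpa using hj i)⟩
  · have h1 : ∀ j, lam' j * (((u i * Z j i : ℤ) : ℝ) * ((u k * Z j k : ℤ) : ℝ)) =
        u i * u k * (lam' j * (Z j i * Z j k)) := fun j => by push_cast; ring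
    simp_rw [h1]
    rw [← Finset.mul_sum, h.orth i k hik, mul_zero]
  · have h1 : ∀ j, lam' j * ((u i * Z j i : ℤ) : ℝ) ^ 2 =
        ((u i ^ 2 : ℤ) : ℝ) * (lam' j * Z j i ^ 2) :=
      fun j => by push_cast; ring
    simp_rw [h1]
    rw [← Finset.mul_sum, h.diag i, hsq]
    norm_num
  · simp_rw [mul_pow, hsq, one_mul]
    exact h.integral_row j fun i => (hdvd j i).1 (hj i)

/-- If there are as many rows as columns, orthogonality of the columns implies orthogonality of the
rows for the inverse weights. -/
theorem orth_rows (h : IsQuarterRelation r Z lam lam') (hcard : Fintype.card κ = Fintype.card ι)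
    {j k : κ} (hjk : j ≠ k) : ∑ i, (Z j i * Z k i : ℝ) / lam i = 0 := by
  classical
  let M : Matrix κ ι ℝ := Matrix.of fun j i => (Z j i : ℝ)
  let N : Matrix ι κ ℝ := Matrix.of fun i j => lam' j * Z j i / (16 * lam i)
  have hNM : N * M = 1 := by
    ext i k
    have hi := (h.pos i).ne'
    have h1 : (N * M) i k = (∑ j, lam' j * (Z j i * Z j k)) / (16 * lam i) := by
      rw [Matrix.mul_apply, Finset.sum_div]
      refine Finset.sum_congr rfl fun j _ => ?_
      simp only [N, M, Matrix.of_apply]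
      ring
    rw [h1, Matrix.one_apply]
    split_ifs with hik
    · subst hik
      simp_rw [← sq]
      rw [h.diag]
      field_simp
    · rw [h.orth i k hik, zero_div]
  have hMN : M * N = 1 := (Matrix.mul_eq_one_comm_of_card_eq ι κ ℝ hcard.symm).1 hNM
  have h2 := congrFun (congrFun hMN j) k
  rw [Matrix.one_apply_ne hjk, Matrix.mul_apply] at h2
  have h3 : ∑ i, M j i * N i k = lam' k / 16 * ∑ i, (Z j i * Z k i : ℝ) / lam i := by
    rw [Finset.mul_sum]
    refine Finset.sum_congr rfl fun i _ => ?_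
    simp only [N, M, Matrix.of_apply]
    have hi := (h.pos i).ne'
    field_simp
  rw [h3] at h2
  have hk := h.pos' k
  exact (mul_eq_zero.1 h2).resolve_left (by positivity)

end IsQuarterRelation

theorem exists_equiv_append {ι : Type*} [Fintype ι] {r : ι → ℤ} (hr : ∀ i, r i = 1 ∨ r i = 2)
    {m₁ m₂ : ℕ} (h1 : (Finset.univ.filter (r · = 1)).card = m₁)
    (h2 : (Finset.univ.filter (r · = 2)).card = m₂) :
    ∃ σ : Fin (m₁ + m₂) ≃ ι,
      (fun i => r (σ i)) = Fin.append (fun _ : Fin m₁ => (1 : ℤ)) fun _ : Fin m₂ => (2 : ℤ) := by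
  classical
  have c1 : Fintype.card (Fin m₁) = Fintype.card {i // r i = 1} := by
    rw [Fintype.card_fin, Fintype.card_subtype, h1]
  have c2 : Fintype.card (Fin m₂) = Fintype.card {i // ¬ r i = 1} := by
    rw [Fintype.card_fin, Fintype.card_subtype, ← h2]
    congr 1
    refine Finset.filter_congr fun i _ => ?_
    rcases hr i with h | h <;> simp [h]
  let ε₁ := Fintype.equivOfCardEq c1
  let ε₂ := Fintype.equivOfCardEq c2
  refine ⟨finSumFinEquiv.symm.trans ((ε₁.sumCongr ε₂).trans (Equiv.sumCompl (r · = 1))), ?_⟩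
  funext i
  refine Fin.addCases (fun i => ?_) (fun i => ?_) i
  · simp [(ε₁ i).2]
  · simp [(hr _).resolve_left (ε₂ i).2]

/-- The coefficients `1, …, 1, 2, …, 2` as integers. -/
def quarterWeight (m₁ m₂ : ℕ) : Fin (m₁ + m₂) → ℤ := Fin.append (fun _ => 1) fun _ => 2

/-- Four times the coordinates of the vectors of `watsonSystem f` with respect to `f`. -/
def watsonMatrix (m₁ m₂ : ℕ) (p k : Fin (m₁ + m₂)) : ℤ :=
  quarterWeight m₁ m₂ k - if k = p then 4 else 0

/-- Four times the coordinates of the vectors of `gluedSystem f` with respect to `f`. -/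
def gluedMatrix : Fin (4 + 3) → Fin (4 + 3) → ℤ :=
  ![![1, 1, 1, 1, 2, 2, 2], ![1, 1, 1, 1, 2, -2, -2], ![1, 1, 1, 1, -2, 2, -2],
    ![1, 1, 1, 1, -2, -2, 2], ![2, 2, -2, -2, 0, 0, 0], ![2, -2, 2, -2, 0, 0, 0],
    ![2, -2, -2, 2, 0, 0, 0]]

/-- Up to the numbering and the signs of the rows, and the signs `u` of the columns, `Z` is the
matrix `G`, with weights proportional to `q`. -/
def IsStandardForm {ι κ : Type*} (q : ι → ℤ) (G : ι → ι → ℤ) (Z : κ → ι → ℤ)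
    (lam : ι → ℝ) (lam' : κ → ℝ) : Prop :=
  ∃ (u : ι → ℤ) (c : ℝ) (τ : ι ≃ κ), (∀ i, u i = 1 ∨ u i = -1) ∧ 0 < c ∧
    (∀ p, (∀ k, Z (τ p) k = u k * G p k) ∨ ∀ k, Z (τ p) k = -(u k * G p k)) ∧
    (∀ i, lam i = c * q i) ∧ ∀ i, lam' (τ i) = c * q i

theorem sum_mul_comp_eq {κ P : Type*} [Fintype κ] [Fintype P] [DecidableEq P] (lam' : κ → ℝ)
    (ψ : κ → P) (F : P → ℝ) : ∑ j, lam' j * F (ψ j) = ∑ p, (∑ j with ψ j = p, lam' j) * F p := by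
  rw [← Finset.sum_fiberwise (s := Finset.univ) (g := ψ)]
  refine Finset.sum_congr rfl fun p _ => ?_
  rw [Finset.sum_mul]
  exact Finset.sum_congr rfl fun j hj => by rw [(Finset.mem_filter.1 hj).2]

/-- A map onto a set of the same cardinality as its source is a bijection; here surjectivity is
obtained by showing that all fibres have positive weight. -/
theorem exists_equiv_of_fiber_pos {κ P : Type*} [Fintype κ] [Fintype P] [DecidableEq P]
    (hcard : Fintype.card κ = Fintype.card P) (lam' : κ → ℝ) (ψ : κ → P)
    (hpos : ∀ p, 0 < ∑ j with ψ j = p, lam' j) :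
    ∃ τ : P ≃ κ, ∀ p, ψ (τ p) = p ∧ lam' (τ p) = ∑ j with ψ j = p, lam' j := by
  have hsurj : Function.Surjective ψ := by
    intro p
    by_contra! hp
    exact (hpos p).ne' (by simp [hp])
  have hbij : Function.Bijective ψ :=
    (Fintype.bijective_iff_surjective_and_card ψ).2 ⟨hsurj, hcard⟩
  have hτ : ∀ p, ψ ((Equiv.ofBijective ψ hbij).symm p) = p :=
    (Equiv.ofBijective ψ hbij).apply_symm_apply
  refine ⟨(Equiv.ofBijective ψ hbij).symm, fun p => ⟨hτ p, ?_⟩⟩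
  have : Finset.univ.filter (fun j => ψ j = p) = {(Equiv.ofBijective ψ hbij).symm p} := by
    ext j
    simp only [Finset.mem_filter, Finset.mem_univ, true_and, Finset.mem_singleton]
    exact ⟨fun hj => hbij.1 (by rw [hτ, hj]), fun hj => by rw [hj, hτ]⟩
  rw [this, Finset.sum_singleton]

namespace IsQuarterRelation

variable {κ : Type*} [Fintype κ]

/-- For `(m₁, m₂) = (8, 0)`, two distinct columns have inner product `∑ μ_p - 4 μ_k - 4 μ_l`, where
`μ_p` is the total weight of the rows of type `p`; hence all the `μ_p` are equal, and each type
occurs. -/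
theorem watson_eight {Z : κ → Fin (8 + 0) → ℤ} {lam : Fin (8 + 0) → ℝ} {lam' : κ → ℝ}
    (h : IsQuarterRelation (quarterWeight 8 0) Z lam lam') (hcard : Fintype.card κ = 8)
    (hrow : ∀ j, ∃ p, ∀ k, Z j k = watsonMatrix 8 0 p k) :
    IsStandardForm (quarterWeight 8 0) (watsonMatrix 8 0) Z lam lam' := by
  have hq : ∀ k, quarterWeight 8 0 k = 1 := by decide
  choose ψ hψ using hrow
  have horth : ∀ k l, k ≠ l → ∑ p, (∑ j with ψ j = p, lam' j) *
      (watsonMatrix 8 0 p k * watsonMatrix 8 0 p l : ℝ) = 0 := by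
    intro k l hkl
    rw [← sum_mul_comp_eq lam' ψ fun p => (watsonMatrix 8 0 p k * watsonMatrix 8 0 p l : ℝ)]
    simpa only [← hψ] using h.orth k l hkl
  have hdiag : ∀ k, ∑ p, (∑ j with ψ j = p, lam' j) *
      (watsonMatrix 8 0 p k : ℝ) ^ 2 = 16 * lam k := by
    intro k
    rw [← sum_mul_comp_eq lam' ψ fun p => (watsonMatrix 8 0 p k : ℝ) ^ 2]
    simpa only [← hψ] using h.diag k
  set μ : Fin (8 + 0) → ℝ := fun p => ∑ j with ψ j = p, lam' j with hμ
  have horth' : ∀ k l, k ≠ l → ∑ p, μ p = 4 * μ k + 4 * μ l := by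
    intro k l hkl
    have := horth k l hkl
    have e : ∀ p, μ p * (watsonMatrix 8 0 p k * watsonMatrix 8 0 p l : ℝ) =
        μ p - (if k = p then 4 * μ p else 0) - (if l = p then 4 * μ p else 0) := by
      intro p
      simp only [watsonMatrix, hq]
      by_cases h1 : k = p
      · have h2 : l ≠ p := fun h2 => hkl (h1.trans h2.symm)
        simp [h1, h2]; ring
      · by_cases h2 : l = p
        · simp [h1, h2]; ring
        · simp [h1, h2]
    simp_rw [hμ] at e
    simp_rw [e] at this
    simp only [Finset.sum_sub_distrib, Finset.sum_ite_eq, Finset.mem_univ, if_true] at this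
    simp only [hμ]
    linarith
  have hconst : ∀ k, μ k = μ 0 := by
    intro k
    by_cases hk : k = 0
    · rw [hk]
    obtain ⟨l, hl0, hlk⟩ : ∃ l : Fin (8 + 0), l ≠ 0 ∧ l ≠ k := by
      revert hk; revert k; decide
    have := horth' k l hlk.symm
    have := horth' 0 l hl0.symm
    linarith
  have hsum : ∑ p, μ p = ∑ j, lam' j := by
    simp only [hμ]
    exact Finset.sum_fiberwise _ _ _
  have hne : Nonempty κ := Fintype.card_pos_iff.1 (by omega)
  have hpos : 0 < ∑ j, lam' j := Finset.sum_pos (fun j _ => h.pos' j) Finset.univ_nonempty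
  have h0 : 0 < μ 0 := by
    rw [← hsum, Finset.sum_congr rfl fun k _ => hconst k] at hpos
    simpa using hpos
  obtain ⟨τ, hτ⟩ := exists_equiv_of_fiber_pos (by rw [hcard, Fintype.card_fin]) lam' ψ
    fun p => by have := hconst p; simp only [hμ] at this h0; rw [this]; exact h0
  refine ⟨fun _ => 1, μ 0, τ, fun _ => Or.inl rfl, h0, fun p => Or.inl fun k => ?_, fun k => ?_,
    fun p => ?_⟩
  · rw [hψ, (hτ p).1, one_mul]
  · have := hdiag k
    have e : ∀ p, μ p * (watsonMatrix 8 0 p k : ℝ) ^ 2 = μ 0 + if k = p then 8 * μ 0 else 0 := by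
      intro p
      rw [hconst]
      simp only [watsonMatrix, hq]
      by_cases h1 : k = p
      · simp [h1]; ring
      · simp [h1]
    simp_rw [hμ] at e
    simp_rw [e] at this
    simp only [Finset.sum_add_distrib, Finset.sum_ite_eq, Finset.mem_univ, if_true,
      Finset.sum_const, Finset.card_univ, Fintype.card_fin, nsmul_eq_mul] at this
    rw [hq]
    simp only [hμ]
    push_cast at this ⊢
    linarith
  · rw [hq, (hτ p).2, Int.cast_one, mul_one]
    exact hconst p

/-- The orthogonality of the first six columns determines the weights of the seven types of rows,
which therefore all occur; the orthogonality of these columns with the last one determines the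
signs in the last column. -/
theorem watson_six_one {Z : κ → Fin (6 + 1) → ℤ} {lam : Fin (6 + 1) → ℝ} {lam' : κ → ℝ}
    (h : IsQuarterRelation (quarterWeight 6 1) Z lam lam') (hcard : Fintype.card κ = 7)
    (hrow : ∀ j, ∃ p, (∀ k, k ≠ 6 → Z j k = watsonMatrix 6 1 p k) ∧ (Z j 6 = 2 ∨ Z j 6 = -2)) :
    IsStandardForm (quarterWeight 6 1) (watsonMatrix 6 1) Z lam lam' := by
  have hW : watsonMatrix 6 1 = ![![-3, 1, 1, 1, 1, 1, 2], ![1, -3, 1, 1, 1, 1, 2],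
      ![1, 1, -3, 1, 1, 1, 2], ![1, 1, 1, -3, 1, 1, 2], ![1, 1, 1, 1, -3, 1, 2],
      ![1, 1, 1, 1, 1, -3, 2], ![1, 1, 1, 1, 1, 1, -2]] := by decide
  have hq : quarterWeight 6 1 = ![1, 1, 1, 1, 1, 1, 2] := by decide
  choose ψ hψ hψ6 using hrow
  have horth : ∀ k l, k ≠ 6 → l ≠ 6 → k ≠ l → ∑ p, (∑ j with ψ j = p, lam' j) *
      (watsonMatrix 6 1 p k * watsonMatrix 6 1 p l : ℝ) = 0 := by
    intro k l hk hl hkl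
    rw [← sum_mul_comp_eq lam' ψ fun p => (watsonMatrix 6 1 p k * watsonMatrix 6 1 p l : ℝ)]
    simpa only [← hψ _ k hk, ← hψ _ l hl] using h.orth k l hkl
  have hsum : ∑ p, (∑ j with ψ j = p, lam' j) = ∑ j, lam' j := Finset.sum_fiberwise _ _ _
  have hne : Nonempty κ := Fintype.card_pos_iff.1 (by omega)
  have hpos : 0 < ∑ j, lam' j := Finset.sum_pos (fun j _ => h.pos' j) Finset.univ_nonempty
  rw [← hsum] at hpos
  obtain ⟨μ, hμ⟩ : ∃ μ : Fin (6 + 1) → ℝ, ∀ p, ∑ j with ψ j = p, lam' j = μ p :=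
    ⟨_, fun _ => rfl⟩
  simp only [hμ] at horth hpos
  have hw : ∃ c, 0 < c ∧ μ = ![c, c, c, c, c, c, 2 * c] := by
    have o1 := horth 0 1 (by decide) (by decide) (by decide)
    have o2 := horth 0 2 (by decide) (by decide) (by decide)
    have o3 := horth 0 3 (by decide) (by decide) (by decide)
    have o4 := horth 0 4 (by decide) (by decide) (by decide)
    have o5 := horth 0 5 (by decide) (by decide) (by decide)
    have o12 := horth 1 2 (by decide) (by decide) (by decide)
    simp [Fin.sum_univ_seven, hW] at o1 o2 o3 o4 o5 o12 hpos
    refine ⟨μ 0, by linarith, ?_⟩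
    funext p
    fin_cases p <;> simp <;> linarith
  obtain ⟨c, hc, rfl⟩ := hw
  obtain ⟨τ, hτ⟩ := exists_equiv_of_fiber_pos (by rw [hcard, Fintype.card_fin]) lam' ψ fun p => by
    rw [hμ]
    fin_cases p <;> simp [hc]
  have hZ : ∀ p k, k ≠ 6 → Z (τ p) k = watsonMatrix 6 1 p k := fun p k hk => by
    rw [hψ _ k hk, (hτ p).1]
  have hτ' := fun p => (hτ p).2.trans (hμ p)
  have ho := fun (k : Fin (6 + 1)) (hk : k ≠ 6) =>
    (τ.sum_comp fun j => lam' j * (Z j k * Z j 6 : ℝ)).trans (h.orth k 6 hk)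
  have hd := fun k => (τ.sum_comp fun j => lam' j * (Z j k : ℝ) ^ 2).trans (h.diag k)
  have hlast : ∀ p, p ≠ 6 → Z (τ p) 6 = -Z (τ 6) 6 := by
    have o0 := ho 0 (by decide)
    have o1 := ho 1 (by decide)
    have o2 := ho 2 (by decide)
    have o3 := ho 3 (by decide)
    have o4 := ho 4 (by decide)
    have o5 := ho 5 (by decide)
    simp [Fin.sum_univ_seven, hτ', hZ, hW] at o0 o1 o2 o3 o4 o5
    have e : ∀ p, p ≠ 6 → c * (Z (τ p) 6 + Z (τ 6) 6 : ℝ) = 0 := by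
      intro p hp
      fin_cases p
      · change c * (Z (τ 0) 6 + _ : ℝ) = 0
        linarith
      · change c * (Z (τ 1) 6 + _ : ℝ) = 0
        linarith
      · change c * (Z (τ 2) 6 + _ : ℝ) = 0
        linarith
      · change c * (Z (τ 3) 6 + _ : ℝ) = 0
        linarith
      · change c * (Z (τ 4) 6 + _ : ℝ) = 0
        linarith
      · change c * (Z (τ 5) 6 + _ : ℝ) = 0
        linarith
      · exact absurd rfl hp
    intro p hp
    have := (mul_eq_zero.1 (e p hp)).resolve_left hc.ne'
    have : ((Z (τ p) 6 + Z (τ 6) 6 : ℤ) : ℝ) = 0 := by exact_mod_cast this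
    have := Int.cast_eq_zero.1 this
    linarith
  have hlam : ∀ k, lam k = c * quarterWeight 6 1 k := by
    intro k
    have hdk := hd k
    have hsq : ∀ p, (Z (τ p) 6 : ℝ) ^ 2 = 4 := fun p => by
      rcases hψ6 (τ p) with h6 | h6 <;> rw [h6] <;> norm_num
    fin_cases k <;> simp [Fin.sum_univ_seven, hτ', hZ, hW, hq, hsq] at hdk ⊢ <;> linarith
  -- The sign of the last column is the sign that gives `e - e_7` its coordinate `-2 / 4`.
  obtain ⟨v, hv, hv6⟩ : ∃ v : ℤ, (v = 1 ∨ v = -1) ∧ Z (τ 6) 6 = v * -2 := by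
    rcases hψ6 (τ 6) with h6 | h6
    · exact ⟨-1, by simp, by simpa using h6⟩
    · exact ⟨1, by simp, by simpa using h6⟩
  refine ⟨fun k => if k = 6 then v else 1, c, τ, fun k => ?_, hc, fun p => Or.inl fun k => ?_, hlam,
    fun p => ?_⟩
  · dsimp only
    split_ifs
    · exact hv
    · exact Or.inl rfl
  · dsimp only
    split_ifs with hk
    · subst hk
      by_cases hp : p = 6
      · subst hp
        rw [hv6, hW]; simp
      · rw [hlast p hp, hv6, hW]
        fin_cases p <;> simp at hp ⊢
    · rw [hZ p k hk, one_mul]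
  · rw [hτ', hq]
    fin_cases p <;> simp [mul_comm]

/-- Rows that are orthogonal and nonzero are distinct up to sign. -/
theorem injective_of_row_eq {ι P : Type*} [Fintype ι] {r : ι → ℤ} {Z : κ → ι → ℤ} {lam : ι → ℝ}
    {lam' : κ → ℝ} (h : IsQuarterRelation r Z lam lam') (hcard : Fintype.card κ = Fintype.card ι)
    (hne : ∀ j, ∃ i, Z j i ≠ 0) {G : P → ι → ℤ} {ψ : κ → P}
    (hψ : ∀ j, Z j = G (ψ j) ∨ Z j = -G (ψ j)) : Function.Injective ψ := by
  intro j k hjk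
  by_contra hne'
  have ho := h.orth_rows hcard hne'
  have hpos : 0 < ∑ i, (Z k i * Z k i : ℝ) / lam i := by
    obtain ⟨i, hi⟩ := hne k
    refine Finset.sum_pos' (fun i _ => div_nonneg (mul_self_nonneg _) (h.pos i).le)
      ⟨i, Finset.mem_univ i, div_pos ?_ (h.pos i)⟩
    exact mul_self_pos.2 (Int.cast_ne_zero.2 hi)
  have hZ : Z j = Z k ∨ Z j = -Z k := by
    have hj := hψ j
    rw [hjk] at hj
    rcases hj with hj | hj <;> rcases hψ k with hk | hk <;> simp [hj, hk]
  rcases hZ with hZ | hZ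
  · rw [hZ] at ho
    linarith
  · simp [hZ, neg_div] at ho
    linarith

/-- Orthogonality of the rows to one row congruent to `r` leaves only the rows of the glued system, or
at most five rows. -/
theorem glued_four_three {Z : κ → Fin (4 + 3) → ℤ} {lam : Fin (4 + 3) → ℝ} {lam' : κ → ℝ}
    (h : IsQuarterRelation (quarterWeight 4 3) Z lam lam') (hcard : Fintype.card κ = 7)
    (hrow : ∀ j, ((∀ i, i < 4 → Z j i = 1) ∧ ∀ i, 4 ≤ i → Z j i = 2 ∨ Z j i = -2) ∨
      ((∀ i, i < 4 → Z j i = 2 ∨ Z j i = -2) ∧ ∀ i, 4 ≤ i → Z j i = 0)) :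
    IsStandardForm (fun _ => 1) gluedMatrix Z lam lam' := by
  have hq : quarterWeight 4 3 = ![1, 1, 1, 1, 2, 2, 2] := by decide
  -- One row that is congruent to `r` may be supposed to be equal to `r`.
  obtain ⟨j₀, hj₀⟩ := h.exists_row
  have hj₀' : (∀ i, i < 4 → Z j₀ i = 1) ∧ ∀ i, 4 ≤ i → Z j₀ i = 2 ∨ Z j₀ i = -2 := by
    refine (hrow j₀).resolve_right fun hcon => ?_
    have h1 := hj₀ 0
    rcases hcon.1 0 (by decide) with h0 | h0 <;> rw [h0, hq] at h1 <;> revert h1 <;> decide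
  obtain ⟨u, hu, hu1, hu0⟩ : ∃ u : Fin (4 + 3) → ℤ, (∀ i, u i = 1 ∨ u i = -1) ∧
      (∀ i, i < 4 → u i = 1) ∧ ∀ i, u i * Z j₀ i = quarterWeight 4 3 i := by
    have : ∀ i, ∃ v : ℤ, (v = 1 ∨ v = -1) ∧ (i < 4 → v = 1) ∧ v * Z j₀ i = quarterWeight 4 3 i := by
      intro i
      by_cases hi : i < 4
      · refine ⟨1, Or.inl rfl, fun _ => rfl, ?_⟩
        rw [hj₀'.1 i hi, hq]
        revert hi; revert i; decide
      · have h2 : quarterWeight 4 3 i = 2 := by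
          rw [hq]; revert hi; revert i; decide
        rcases hj₀'.2 i (not_lt.1 hi) with h3 | h3
        · exact ⟨1, Or.inl rfl, fun h => absurd h hi, by rw [h2, h3]; norm_num⟩
        · exact ⟨-1, Or.inr rfl, fun h => absurd h hi, by rw [h2, h3]; norm_num⟩
    choose u h1 h2 h3 using this
    exact ⟨u, h1, h2, h3⟩
  have hlt : ∀ i : Fin (4 + 3), quarterWeight 4 3 i = 1 → i < 4 := by rw [hq]; decide
  replace h := h.signs hu fun i hi => hu1 i (hlt i hi)
  have hrow' : ∀ j, ((∀ i, i < 4 → u i * Z j i = 1) ∧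
        ∀ i, 4 ≤ i → u i * Z j i = 2 ∨ u i * Z j i = -2) ∨
      ((∀ i, i < 4 → u i * Z j i = 2 ∨ u i * Z j i = -2) ∧ ∀ i, 4 ≤ i → u i * Z j i = 0) := by
    intro j
    refine (hrow j).imp (fun hj => ⟨fun i hi => ?_, fun i hi => ?_⟩) fun hj =>
      ⟨fun i hi => ?_, fun i hi => ?_⟩
    · rw [hu1 i hi, hj.1 i hi, one_mul]
    · rcases hu i with h1 | h1 <;> rcases hj.2 i hi with h2 | h2 <;> rw [h1, h2] <;> norm_num
    · rw [hu1 i hi, one_mul]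
      exact hj.1 i hi
    · rw [hj.2 i hi, mul_zero]
  obtain ⟨Y, hY⟩ : ∃ Y : κ → Fin (4 + 3) → ℤ, ∀ j i, u i * Z j i = Y j i := ⟨_, fun _ _ => rfl⟩
  simp only [hY] at h hrow' hu0
  -- It remains to treat `Y`, whose row `j₀` is known.
  suffices hstd : ∃ (c : ℝ) (τ : Fin (4 + 3) ≃ κ), 0 < c ∧
      (∀ p, Y (τ p) = gluedMatrix p ∨ Y (τ p) = -gluedMatrix p) ∧
      (∀ i, lam i = c) ∧ ∀ i, lam' (τ i) = c by
    obtain ⟨c, τ, hc, hτ, hl, hl'⟩ := hstd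
    have hZ : ∀ j i, Z j i = u i * Y j i := fun j i => by
      rw [← hY, ← mul_assoc]
      rcases hu i with h1 | h1 <;> rw [h1] <;> norm_num
    refine ⟨u, c, τ, hu, hc, fun p => (hτ p).imp (fun hp k => ?_) fun hp k => ?_, by simpa using hl,
      by simpa using hl'⟩
    · rw [hZ, hp]
    · rw [hZ, hp, Pi.neg_apply, mul_neg]
  have hcard' : Fintype.card κ = Fintype.card (Fin (4 + 3)) := by rw [hcard, Fintype.card_fin]
  have hab : ∀ i k, (∀ j, Y j i ^ 2 = Y j k ^ 2) → lam i = lam k := by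
    intro i k hik
    have h1 := h.diag i
    have h2 := h.diag k
    have h3 : ∀ j, (Y j i : ℝ) ^ 2 = (Y j k : ℝ) ^ 2 := fun j => by exact_mod_cast hik j
    simp_rw [h3] at h1
    linarith
  have hsq : ∀ j i, (i < 4 → Y j i ^ 2 = Y j 0 ^ 2) ∧ (4 ≤ i → Y j i ^ 2 = Y j 4 ^ 2) := by
    intro j i
    have h04 : (0 : Fin (4 + 3)) < 4 := by decide
    rcases hrow' j with ⟨ha, hb⟩ | ⟨ha, hb⟩
    · refine ⟨fun hi => by rw [ha i hi, ha 0 h04], fun hi => ?_⟩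
      rcases hb i hi with h1 | h1 <;> rcases hb 4 le_rfl with h2 | h2 <;> rw [h1, h2] <;> norm_num
    · refine ⟨fun hi => ?_, fun hi => by rw [hb i hi, hb 4 le_rfl]⟩
      rcases ha i hi with h1 | h1 <;> rcases ha 0 h04 with h2 | h2 <;> rw [h1, h2] <;> norm_num
  have hlam : ∀ i, lam i = if i < 4 then lam 0 else lam 4 := by
    intro i
    split_ifs with hi
    · exact hab i 0 fun j => (hsq j i).1 hi
    · exact hab i 4 fun j => (hsq j i).2 (not_lt.1 hi)
  have hY0 : Y j₀ = ![1, 1, 1, 1, 2, 2, 2] := by rw [← hq]; exact funext hu0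
  have horth : ∀ j, j ≠ j₀ → lam 4 * (Y j 0 + Y j 1 + Y j 2 + Y j 3) +
      2 * lam 0 * (Y j 4 + Y j 5 + Y j 6) = 0 := by
    intro j hj
    have h0 := (h.pos 0).ne'
    have h4 := (h.pos 4).ne'
    have ho := h.orth_rows hcard' hj
    have l1 : lam 1 = lam 0 := hlam 1
    have l2 : lam 2 = lam 0 := hlam 2
    have l3 : lam 3 = lam 0 := hlam 3
    have l5 : lam 5 = lam 4 := hlam 5
    have l6 : lam 6 = lam 4 := hlam 6
    simp [Fin.sum_univ_seven, hY0, l1, l2, l3, l5, l6] at ho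
    field_simp at ho
    linarith
  have hp0 := h.pos 0
  have hp4 := h.pos 4
  -- The rows congruent to `2 r` have two coordinates of each sign.
  have heven : ∀ j, Y j 0 = 2 ∨ Y j 0 = -2 → ∃ p : Fin 3, Y j = gluedMatrix (Fin.natAdd 4 p) ∨
      Y j = -gluedMatrix (Fin.natAdd 4 p) := by
    intro j hj
    obtain ⟨ha, hb⟩ := (hrow' j).resolve_left fun hcon => by
      rw [hcon.1 0 (by decide)] at hj
      omega
    have ho := horth j fun hj' => by
      rw [hj', hY0] at hj
      simp at hj
    have h4 := hb 4 (by decide)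
    have h5 := hb 5 (by decide)
    have h6 := hb 6 (by decide)
    rw [h4, h5, h6] at ho
    have ho' : ((Y j 0 + Y j 1 + Y j 2 + Y j 3 : ℤ) : ℝ) = 0 := by
      have : lam 4 * ((Y j 0 + Y j 1 + Y j 2 + Y j 3 : ℤ) : ℝ) = 0 := by
        push_cast at ho ⊢
        linarith
      exact (mul_eq_zero.1 this).resolve_left hp4.ne'
    replace ho := Int.cast_eq_zero.1 ho'
    have hvec : Y j = ![Y j 0, Y j 1, Y j 2, Y j 3, 0, 0, 0] := by
      funext i
      fin_cases i <;> simp [h4, h5, h6]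
    have h1 := ha 1 (by decide)
    have h2 := ha 2 (by decide)
    have h3 := ha 3 (by decide)
    rw [hvec]
    generalize Y j 0 = y0 at *
    generalize Y j 1 = y1 at *
    generalize Y j 2 = y2 at *
    generalize Y j 3 = y3 at *
    clear hvec ha hb
    rcases hj with rfl | rfl <;> rcases h1 with rfl | rfl <;> rcases h2 with rfl | rfl <;>
      rcases h3 with rfl | rfl <;> first | (norm_num at ho; done) | decide
  have hodd : ∀ j, Y j 0 = 1 → Y j = ![1, 1, 1, 1, 2, 2, 2] ∨
      (lam 4 = lam 0 ∧ ∃ p : Fin 4, Y j = gluedMatrix (Fin.castAdd 3 p)) ∨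
      (lam 4 = 3 * lam 0 ∧ Y j = ![1, 1, 1, 1, -2, -2, -2]) := by
    intro j hj
    by_cases hj₀'' : j = j₀
    · exact Or.inl (hj₀'' ▸ hY0)
    right
    obtain ⟨ha, hb⟩ := (hrow' j).resolve_right fun hcon => by
      have := hcon.1 0 (by decide)
      omega
    have ho := horth j hj₀''
    have h1 := ha 1 (by decide)
    have h2 := ha 2 (by decide)
    have h3 := ha 3 (by decide)
    rw [hj, h1, h2, h3] at ho
    have hvec : Y j = ![1, 1, 1, 1, Y j 4, Y j 5, Y j 6] := by
      funext i
      fin_cases i <;> simp [hj, h1, h2, h3]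
    have h4 := hb 4 (by decide)
    have h5 := hb 5 (by decide)
    have h6 := hb 6 (by decide)
    rw [hvec]
    generalize Y j 4 = y4 at *
    generalize Y j 5 = y5 at *
    generalize Y j 6 = y6 at *
    clear hvec ha hb
    rcases h4 with rfl | rfl <;> rcases h5 with rfl | rfl <;> rcases h6 with rfl | rfl <;>
      norm_num at ho <;>
      first
      | (exfalso; linarith)
      | exact Or.inl ⟨by linarith, by decide⟩
      | exact Or.inr ⟨by linarith, by decide⟩
  have hcase : ∀ j, Y j 0 = 1 ∨ (Y j 0 = 2 ∨ Y j 0 = -2) := fun j =>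
    (hrow' j).imp (fun hj => hj.1 0 (by decide)) fun hj => hj.1 0 (by decide)
  have hne : ∀ j, ∃ i, Y j i ≠ 0 := fun j => ⟨0, by
    rcases hcase j with h0 | h0 | h0 <;> rw [h0] <;> norm_num⟩
  by_cases heq : lam 4 = lam 0
  · have hall : ∀ j, ∃ p, Y j = gluedMatrix p ∨ Y j = -gluedMatrix p := by
      intro j
      rcases hcase j with h0 | h0
      · rcases hodd j h0 with h1 | ⟨-, p, hp⟩ | ⟨h1, -⟩
        · exact ⟨0, Or.inl h1⟩
        · exact ⟨_, Or.inl hp⟩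
        · linarith
      · obtain ⟨p, hp⟩ := heven j h0
        exact ⟨_, hp⟩
    choose ψ hψ using hall
    have hbij : Function.Bijective ψ := (Fintype.bijective_iff_injective_and_card ψ).2
      ⟨h.injective_of_row_eq hcard' hne hψ, hcard'⟩
    let τ := (Equiv.ofBijective ψ hbij).symm
    have hτ : ∀ p, ψ (τ p) = p := (Equiv.ofBijective ψ hbij).apply_symm_apply
    have hYτ : ∀ p, Y (τ p) = gluedMatrix p ∨ Y (τ p) = -gluedMatrix p := fun p => by
      have := hψ (τ p)
      rwa [hτ] at this
    have hmul : ∀ p k l, (Y (τ p) k * Y (τ p) l : ℝ) = gluedMatrix p k * gluedMatrix p l := by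
      intro p k l
      rcases hYτ p with hp | hp <;> simp [hp]
    have ho := fun k l hkl =>
      (τ.sum_comp fun j => lam' j * (Y j k * Y j l : ℝ)).trans (h.orth k l hkl)
    have hd := fun k => (τ.sum_comp fun j => lam' j * (Y j k : ℝ) ^ 2).trans (h.diag k)
    simp only [sq, hmul] at ho hd
    have hweights : (∀ p, lam' (τ p) = lam' (τ 0)) ∧ lam 0 = lam' (τ 0) := by
      have o45 := ho 4 5 (by decide)
      have o46 := ho 4 6 (by decide)
      have o56 := ho 5 6 (by decide)
      have o04 := ho 0 4 (by decide)
      have o05 := ho 0 5 (by decide)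
      have o06 := ho 0 6 (by decide)
      have o01 := ho 0 1 (by decide)
      have o02 := ho 0 2 (by decide)
      have o03 := ho 0 3 (by decide)
      have d0 := hd 0
      simp [Fin.sum_univ_seven, gluedMatrix] at o45 o46 o56 o04 o05 o06 o01 o02 o03 d0
      refine ⟨fun p => ?_, by linarith⟩
      fin_cases p <;> simp <;> linarith
    refine ⟨lam' (τ 0), τ, h.pos' _, hYτ, fun i => ?_, hweights.1⟩
    rw [hlam i, heq, ite_self, hweights.2]
  · exfalso
    let G : Fin 5 → Fin (4 + 3) → ℤ := ![![1, 1, 1, 1, 2, 2, 2], ![1, 1, 1, 1, -2, -2, -2],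
      gluedMatrix 4, gluedMatrix 5, gluedMatrix 6]
    have hall : ∀ j, ∃ p, Y j = G p ∨ Y j = -G p := by
      intro j
      rcases hcase j with h0 | h0
      · rcases hodd j h0 with h1 | ⟨h1, -⟩ | ⟨-, h1⟩
        · exact ⟨0, Or.inl h1⟩
        · exact absurd h1 heq
        · exact ⟨1, Or.inl h1⟩
      · obtain ⟨p, hp⟩ := heven j h0
        refine ⟨Fin.natAdd 2 p, ?_⟩
        fin_cases p <;> exact hp
    choose ψ hψ using hall
    have := Fintype.card_le_of_injective ψ (h.injective_of_row_eq hcard' hne hψ)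
    rw [hcard, Fintype.card_fin] at this
    omega

end IsQuarterRelation

/-! ### The integral relation of a perfection relation -/

theorem IsMinimalVector.norm_eq {E : Type*} [NormedAddCommGroup E] {L : Submodule ℤ E} {x y : E}
    (hx : IsMinimalVector L x)
    (hy : IsMinimalVector L y) : ‖x‖ = ‖y‖ :=
  le_antisymm (hx.2.2 y hy.1 hy.2.1) (hy.2.2 x hx.1 hx.2.1)

theorem norm_eq_of_eq_or_eq_neg {E : Type*} [NormedAddCommGroup E] {x y : E}
    (h : x = y ∨ x = -y) : ‖x‖ = ‖y‖ := by
  rcases h with h | h <;> simp [h]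

section Perfection

variable {E : Type*} [NormedAddCommGroup E] [InnerProductSpace ℝ E] {ι κ : Type*} [Fintype ι]
  [Fintype κ]

/-- For vectors of equal norms `ρ`, the relation multiplied by `ρ²` involves only inner products. -/
theorem sum_inner_smul_eq_of_lineProj {e : ι → E} {e' : κ → E} {lam : ι → ℝ} {lam' : κ → ℝ} {ρ : ℝ}
    (hρ : 0 < ρ) (he : ∀ i, ‖e i‖ = ρ) (he' : ∀ j, ‖e' j‖ = ρ)
    (hrel : ∑ i, lam i • lineProj (e i) = ∑ j, lam' j • lineProj (e' j)) (y : E) :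
    ∑ i, (lam i * inner ℝ (e i) y) • e i = ∑ j, (lam' j * inner ℝ (e' j) y) • e' j := by
  have h := congrArg (fun T : E →L[ℝ] E => (ρ ^ 2) • T y) hrel
  simp only [lineProj, _root_.sum_apply, _root_.smul_apply,
    Submodule.starProjection_singleton, he, he', Finset.smul_sum, smul_smul] at h
  convert h using 2 with i _ j _
  · congr 1
    simp only [RCLike.ofReal_real_eq_id, id_eq]
    field_simp
  · congr 1
    simp only [RCLike.ofReal_real_eq_id, id_eq]
    field_simp

/-- The relation in coordinates: its two sides are quadratic forms on the dual space, the first one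
being diagonal in the coordinates given by `f`. -/
theorem sum_mul_coord_eq [DecidableEq ι] {f : ι → E} {f' : κ → E} {lam : ι → ℝ} {lam' : κ → ℝ}
    {Z : κ → ι → ℤ} (hind : LinearIndependent ℝ f)
    (hrel : ∀ y, ∑ i, (lam i * inner ℝ (f i) y) • f i = ∑ j, (lam' j * inner ℝ (f' j) y) • f' j)
    (hZ : ∀ j, (4 : ℝ) • f' j = ∑ i, (Z j i : ℝ) • f i) (i k : ι) :
    ∑ j, lam' j * (Z j i * Z j k : ℝ) = if k = i then 16 * lam i else 0 := by
  have h1 : ∀ y, ∑ i, (16 * lam i * inner ℝ (f i) y) • f i =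
      ∑ i, (∑ j, lam' j * Z j i * ∑ k, Z j k * inner ℝ (f k) y) • f i := by
    intro y
    have h := congrArg (fun v : E => (16 : ℝ) • v) (hrel y)
    simp only [Finset.smul_sum, smul_smul] at h
    simp_rw [mul_assoc]
    rw [h]
    simp_rw [Finset.sum_smul]
    rw [Finset.sum_comm]
    refine Finset.sum_congr rfl fun j _ => ?_
    have hin : 4 * inner ℝ (f' j) y = ∑ k, Z j k * inner ℝ (f k) y := by
      have := congrArg (fun v : E => inner ℝ v y) (hZ j)
      simpa only [sum_inner, real_inner_smul_left] using this
    have h2 : ∀ i, (lam' j * (Z j i * ∑ k, Z j k * inner ℝ (f k) y)) • f i =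
        (4 * lam' j * inner ℝ (f' j) y) • ((Z j i : ℝ) • f i) := fun i => by
      rw [← hin, smul_smul]
      congr 1
      ring
    simp_rw [h2]
    rw [← Finset.smul_sum, ← hZ, smul_smul]
    congr 1
    ring
  have h2 : ∀ y, 16 * lam i * inner ℝ (f i) y =
      ∑ j, lam' j * Z j i * ∑ k, Z j k * inner ℝ (f k) y := by
    intro y
    have h := h1 y
    rw [← sub_eq_zero, ← Finset.sum_sub_distrib] at h
    simp_rw [← sub_smul] at h
    exact sub_eq_zero.1 (Fintype.linearIndependent_iff.1 hind _ h i)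
  have h3 : ∑ k, (∑ j, lam' j * (Z j i * Z j k : ℝ) - if k = i then 16 * lam i else 0) • f k = 0 := by
    refine ext_inner_right ℝ fun y => ?_
    rw [sum_inner, inner_zero_left]
    simp_rw [real_inner_smul_left, sub_mul, Finset.sum_sub_distrib, ite_mul, zero_mul]
    rw [Finset.sum_ite_eq' Finset.univ i, if_pos (Finset.mem_univ i), h2 y, sub_eq_zero]
    simp_rw [Finset.mul_sum, Finset.sum_mul]
    rw [Finset.sum_comm]
    refine Finset.sum_congr rfl fun j _ => Finset.sum_congr rfl fun k _ => ?_
    ring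
  exact sub_eq_zero.1 (Fintype.linearIndependent_iff.1 hind _ h3 k)

/-- The two sides of the relation have the same trace, as all the vectors have the same norm. -/
theorem sum_eq_of_coord [DecidableEq ι] {f : ι → E} {f' : κ → E} {lam : ι → ℝ} {lam' : κ → ℝ}
    {Z : κ → ι → ℤ} {ρ : ℝ} (hρ : 0 < ρ) (hf : ∀ i, ‖f i‖ = ρ) (hf' : ∀ j, ‖f' j‖ = ρ)
    (hZ : ∀ j, (4 : ℝ) • f' j = ∑ i, (Z j i : ℝ) • f i)
    (hC : ∀ i k, ∑ j, lam' j * (Z j i * Z j k : ℝ) = if k = i then 16 * lam i else 0) :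
    ∑ i, lam i = ∑ j, lam' j := by
  have h1 : ∀ j, 16 * ρ ^ 2 = ∑ i, ∑ k, (Z j i * Z j k : ℝ) * inner ℝ (f i) (f k) := by
    intro j
    have h : inner ℝ ((4 : ℝ) • f' j) ((4 : ℝ) • f' j) = 16 * ρ ^ 2 := by
      rw [real_inner_smul_left, real_inner_smul_right, real_inner_self_eq_norm_sq, hf']
      ring
    rw [← h, hZ, sum_inner]
    simp_rw [inner_sum, real_inner_smul_left, real_inner_smul_right, mul_assoc]
  have h2 : ∑ j, lam' j * (16 * ρ ^ 2) = ∑ i, 16 * lam i * ρ ^ 2 := by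
    rw [Finset.sum_congr rfl fun j _ => congrArg (lam' j * ·) (h1 j)]
    simp_rw [Finset.mul_sum]
    rw [Finset.sum_comm]
    refine Finset.sum_congr rfl fun i _ => ?_
    rw [Finset.sum_comm]
    have : ∀ k, ∑ j, lam' j * ((Z j i * Z j k : ℝ) * inner ℝ (f i) (f k)) =
        (if k = i then 16 * lam i else 0) * inner ℝ (f i) (f k) := by
      intro k
      rw [← hC, Finset.sum_mul]
      exact Finset.sum_congr rfl fun j _ => by ring
    simp_rw [this, ite_mul, zero_mul]
    rw [Finset.sum_ite_eq' Finset.univ i, if_pos (Finset.mem_univ i), real_inner_self_eq_norm_sq, hf]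
  rw [← Finset.sum_mul, ← Finset.sum_mul, ← Finset.mul_sum] at h2
  have hρ2 : 0 < ρ ^ 2 := by positivity
  have h3 : ρ ^ 2 * (∑ i, lam i - ∑ j, lam' j) = 0 := by linarith
  linarith [(mul_eq_zero.1 h3).resolve_left hρ2.ne']

theorem two_le_sum_sq_of_ne [DecidableEq ι] {f : ι → E} {x : E} (hx : x ≠ 0) {z : ι → ℤ}
    (hxz : x = ∑ i, (z i : ℝ) • f i) (hne : ∀ i, x ≠ f i ∧ x ≠ -f i) : 2 ≤ ∑ i, z i ^ 2 := by
  by_contra! hlt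
  obtain ⟨p, hp⟩ : ∃ p, z p ≠ 0 := by
    by_contra! h0
    exact hx (by simp [hxz, h0])
  have hp1 : 0 < z p ^ 2 := by positivity
  have hle : ∀ i ∈ Finset.univ.erase p, 0 ≤ z i ^ 2 := fun i _ => sq_nonneg _
  have hnn := Finset.sum_nonneg hle
  rw [← Finset.add_sum_erase _ _ (Finset.mem_univ p)] at hlt
  have h0 : ∑ i ∈ Finset.univ.erase p, z i ^ 2 = 0 := by omega
  have h1 : z p ^ 2 = 1 := by omega
  rw [Finset.sum_eq_zero_iff_of_nonneg hle] at h0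
  have hx' : x = (z p : ℝ) • f p := by
    rw [hxz, Finset.sum_eq_single_of_mem p (Finset.mem_univ p)]
    intro i _ hi
    rw [(pow_eq_zero_iff two_ne_zero).1 (h0 i (by simp [hi]))]
    simp
  rcases sq_eq_sq_iff_eq_or_eq_neg.1 (h1.trans (one_pow 2).symm) with h2 | h2
  · exact (hne p).1 (by rw [hx', h2]; simp)
  · exact (hne p).2 (by rw [hx', h2]; simp)

theorem Int.exists_sign_mul (c : ℤ) : ∃ s r t : ℤ, (s = 1 ∨ s = -1) ∧ (r = 0 ∨ r = 1 ∨ r = 2) ∧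
    s * c = r + 4 * t := by
  have h := Int.emod_nonneg c (b := 4) (by norm_num)
  have h' := Int.emod_lt_of_pos c (b := 4) (by norm_num)
  have h2 := Int.emod_add_mul_ediv c 4
  by_cases h3 : c % 4 = 3
  · exact ⟨-1, 1, -(c / 4) - 1, by simp, by simp, by omega⟩
  · exact ⟨1, c % 4, c / 4, by simp, by omega, by omega⟩

/-- A perfection relation of cyclic index `4`, in terms of coordinates. The generator of the quotient
is taken among the vectors `e'_j`; the signs of the `e_i` are chosen so that its coordinates are
congruent to `0`, `1/4` or `1/2` modulo `1`. -/
theorem exists_isQuarterRelation {n : ℕ} {L : Submodule ℤ E} {e e' : Fin n → E}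
    {lam lam' : Fin n → ℝ} (hmin : ∀ i, IsMinimalVector L (e i))
    (hmin' : ∀ i, IsMinimalVector L (e' i)) (hrel : IsPerfectionRelation e e' lam lam')
    (hcyc : IsAddCyclic (latticeOfPair e e' ⧸ (latticeOf e).submoduleOf (latticeOfPair e e')))
    (hcard : Nat.card
      (latticeOfPair e e' ⧸ (latticeOf e).submoduleOf (latticeOfPair e e')) = 4) :
    ∃ (f f' : Fin n → E) (r : Fin n → ℤ) (Z : Fin n → Fin n → ℤ),
      (∀ i, f i = e i ∨ f i = -e i) ∧ (∀ j, f' j = e' j ∨ f' j = -e' j) ∧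
      LinearIndependent ℝ f ∧ (∀ j, (4 : ℝ) • f' j = ∑ i, (Z j i : ℝ) • f i) ∧ (∃ i, r i = 1) ∧
      IsQuarterRelation r Z lam lam' := by
  obtain ⟨x, hx, hx2⟩ := exists_two_smul_notMem hcyc hcard
  have hmem' : ∀ j, e' j ∈ latticeOfPair e e' := fun j =>
    (le_sup_right : latticeOf e' ≤ _) (Submodule.subset_span ⟨j, rfl⟩)
  obtain ⟨j₀, hj₀⟩ : ∃ j, (2 : ℤ) • e' j ∉ latticeOf e := by
    by_contra! hcon
    have hle : latticeOfPair e e' ≤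
        (latticeOf e).comap ((2 : ℤ) • (LinearMap.id : E →ₗ[ℤ] E)) := by
      refine sup_le (fun y hy => (latticeOf e).smul_mem 2 hy) (Submodule.span_le.2 ?_)
      rintro _ ⟨j, rfl⟩
      exact hcon j
    exact hx2 (hle hx)
  obtain ⟨c, hc⟩ := mem_latticeOf_iff.1 (four_smul_mem hcard (hmem' j₀))
  have hk : ∀ j, ∃ k : ℤ, (j = j₀ → k = 1) ∧ e' j - k • e' j₀ ∈ latticeOf e := by
    intro j
    by_cases hj : j = j₀
    · exact ⟨1, fun _ => rfl, by simp [hj]⟩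
    · obtain ⟨k, hk⟩ := exists_sub_smul_mem hcard (hmem' j₀) hj₀ (hmem' j)
      exact ⟨k, fun h => absurd h hj, hk⟩
  choose k hk₀ hk using hk
  choose z hz using fun j => mem_latticeOf_iff.1 (hk j)
  choose s r t hs hr hst using fun i => Int.exists_sign_mul (c i)
  choose ε l t' hε hl hεt using fun j => Int.exists_sign_mul (k j)
  have hs2 : ∀ i, s i * s i = 1 := fun i => by rcases hs i with h | h <;> rw [h] <;> norm_num
  set f : Fin n → E := fun i => s i • e i with hf
  set f' : Fin n → E := fun j => ε j • e' j with hf'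
  set Z : Fin n → Fin n → ℤ := fun j i => ε j * s i * (k j * c i + 4 * z j i) with hZdef
  have hfe : ∀ i, f i = e i ∨ f i = -e i := fun i => by
    rcases hs i with h | h <;> simp [hf, h]
  have hfe' : ∀ j, f' j = e' j ∨ f' j = -e' j := fun j => by
    rcases hε j with h | h <;> simp [hf', h]
  have hind : LinearIndependent ℝ f := by
    have := hrel.indep.units_smul fun i => if s i = 1 then (1 : ℝˣ) else -1
    convert this using 1
    funext i
    rcases hs i with h | h <;> simp [hf, h]
  have hZ4 : ∀ j, (4 : ℤ) • f' j = ∑ i, Z j i • f i := by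
    intro j
    have h1 : (4 : ℤ) • e' j = ∑ i, (k j * c i + 4 * z j i) • e i := by
      have h2 : e' j = k j • e' j₀ + ∑ i, z j i • e i := by rw [hz]; abel
      rw [h2, smul_add, smul_comm, ← hc, Finset.smul_sum, Finset.smul_sum, ← Finset.sum_add_distrib]
      exact Finset.sum_congr rfl fun i _ => by rw [add_smul, mul_smul, mul_smul]
    rw [hf']
    dsimp only
    rw [smul_comm, h1, Finset.smul_sum]
    refine Finset.sum_congr rfl fun i _ => ?_
    rw [hf, smul_smul, hZdef]
    dsimp only
    rw [smul_smul, show ε j * s i * (k j * c i + 4 * z j i) * s i =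
      ε j * (k j * c i + 4 * z j i) * (s i * s i) by ring, hs2, mul_one]
  have hZ : ∀ j, (4 : ℝ) • f' j = ∑ i, (Z j i : ℝ) • f i := by
    intro j
    have := hZ4 j
    simp_rw [← Int.cast_smul_eq_zsmul ℝ] at this
    exact_mod_cast this
  have hmod : ∀ j i, Z j i ≡ l j * r i [ZMOD 4] := fun j i =>
    Int.modEq_iff_dvd.2 ⟨-(l j * t i + t' j * r i + 4 * t' j * t i + ε j * s i * z j i), by
      have h1 : Z j i = (ε j * k j) * (s i * c i) + 4 * (ε j * s i * z j i) := by
        simp only [hZdef]; ring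
      rw [h1, hεt, hst]
      ring⟩
  set ρ := ‖e j₀‖
  have hρ : 0 < ρ := norm_pos_iff.2 (hmin j₀).2.1
  have hne : ∀ i, ‖e i‖ = ρ := fun i => (hmin i).norm_eq (hmin j₀)
  have hne' : ∀ j, ‖e' j‖ = ρ := fun j => (hmin' j).norm_eq (hmin j₀)
  have hnf : ∀ i, ‖f i‖ = ρ := fun i => (norm_eq_of_eq_or_eq_neg (hfe i)).trans (hne i)
  have hnf' : ∀ j, ‖f' j‖ = ρ := fun j => (norm_eq_of_eq_or_eq_neg (hfe' j)).trans (hne' j)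
  have hrel' : ∀ y, ∑ i, (lam i * inner ℝ (f i) y) • f i =
      ∑ j, (lam' j * inner ℝ (f' j) y) • f' j := by
    intro y
    convert sum_inner_smul_eq_of_lineProj hρ hne hne' hrel.relation y using 2 with i _ j _
    · rcases hfe i with h | h <;> simp [h]
    · rcases hfe' j with h | h <;> simp [h]
  have hC := sum_mul_coord_eq hind hrel' hZ
  have hr1 : ∃ i, r i = 1 := by
    by_contra! hcon
    refine hj₀ (mem_latticeOf_iff.2 ⟨fun i => s i * (r i / 2 + 2 * t i), ?_⟩)
    have h1 : ∀ i, c i = 2 * (s i * (r i / 2 + 2 * t i)) := by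
      intro i
      have h2 : c i = s i * (r i + 4 * t i) := by
        rw [← hst, ← mul_assoc, hs2, one_mul]
      rw [h2]
      rcases hr i with h | h | h
      · rw [h]; norm_num; ring
      · exact absurd h (hcon i)
      · rw [h]; norm_num; ring
    have h2 : (2 : ℝ) • ∑ i, (s i * (r i / 2 + 2 * t i)) • e i = (2 : ℝ) • (2 : ℤ) • e' j₀ := by
      have h3 : (2 : ℤ) • ∑ i, (s i * (r i / 2 + 2 * t i)) • e i = (2 : ℤ) • (2 : ℤ) • e' j₀ := by
        rw [smul_smul, show (2 : ℤ) * 2 = 4 by norm_num, ← hc, Finset.smul_sum]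
        exact Finset.sum_congr rfl fun i _ => by rw [smul_smul, ← h1]
      rw [← Int.cast_smul_eq_zsmul ℝ 2, ← Int.cast_smul_eq_zsmul ℝ 2] at h3
      exact_mod_cast h3
    exact smul_right_injective E (two_ne_zero' ℝ) h2
  refine ⟨f, f', r, Z, hfe, hfe', hind, hZ, hr1, hr, fun j => ?_, ⟨j₀, fun i => ?_⟩, hrel.pos,
    hrel.pos', fun i k hik => ?_, fun i => ?_, sum_eq_of_coord hρ hnf hnf' hZ hC, fun j hj => ?_⟩
  · rcases hl j with h | h | h
    · exact Or.inr (Or.inr fun i => Int.modEq_zero_iff_dvd.1 (by simpa [h] using hmod j i))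
    · exact Or.inl fun i => by simpa [h] using hmod j i
    · exact Or.inr (Or.inl fun i => by simpa [h] using hmod j i)
  · have h1 := hεt j₀
    rw [hk₀ j₀ rfl] at h1
    have h2 : l j₀ = 1 := by
      have := hε j₀
      have := hl j₀
      omega
    simpa [h2] using hmod j₀ i
  · rw [hC i k, if_neg hik.symm]
  · simp_rw [sq]
    rw [hC i i, if_pos rfl]
  · choose y hy using hj
    have h1 : f' j = ∑ i, (y i : ℝ) • f i := by
      refine smul_right_injective E (four_ne_zero' ℝ) ?_
      dsimp only
      rw [hZ, Finset.smul_sum]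
      refine Finset.sum_congr rfl fun i _ => ?_
      rw [hy, smul_smul]
      push_cast
      rfl
    have h2 : 2 ≤ ∑ i, y i ^ 2 := by
      refine two_le_sum_sq_of_ne (norm_pos_iff.1 (by rw [hnf']; exact hρ)) h1 fun i => ?_
      have hd := hrel.distinct i j
      constructor <;> intro h3 <;> apply hd
      all_goals
        have h4 : e' j = e i ∨ e' j = -e i := by
          rcases hfe i with h | h <;> rcases hfe' j with h' | h' <;> rw [h, h'] at h3
          all_goals first
            | exact Or.inl h3
            | exact Or.inr h3
            | exact Or.inl (neg_injective (by simpa using h3))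
            | exact Or.inr (neg_injective (by simpa using h3))
        rcases h4 with h4 | h4 <;> rw [h4]
        rw [← Set.neg_singleton, Submodule.span_neg]
    simp_rw [hy, mul_pow, ← Finset.mul_sum]
    linarith

end Perfection

/-! ### Back to vectors -/

theorem latticeOf_eq_of_equiv {E : Type*} [NormedAddCommGroup E] {n k : ℕ} {e : Fin n → E}
    {f : Fin k → E} (σ : Fin k ≃ Fin n) (hf : ∀ i, f i = e (σ i) ∨ f i = -e (σ i)) :
    latticeOf e = latticeOf f := by
  refine le_antisymm (Submodule.span_le.2 ?_) (Submodule.span_le.2 ?_)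
  · rintro _ ⟨i, rfl⟩
    have hi : f (σ.symm i) ∈ latticeOf f := Submodule.subset_span ⟨_, rfl⟩
    rcases hf (σ.symm i) with h | h <;> rw [h, σ.apply_symm_apply] at hi
    · exact hi
    · simpa using hi
  · rintro _ ⟨i, rfl⟩
    have hi : e (σ i) ∈ latticeOf e := Submodule.subset_span ⟨_, rfl⟩
    rcases hf i with h | h <;> rw [h]
    · exact hi
    · simpa using hi

section Vectors

variable {E : Type*} [NormedAddCommGroup E] [InnerProductSpace ℝ E] {m₁ m₂ n : ℕ}

theorem quarterWeight_cast (i : Fin (m₁ + m₂)) :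
    (quarterWeight m₁ m₂ i : ℝ) = quarterCoeff m₁ m₂ i := by
  refine Fin.addCases (fun i => ?_) (fun i => ?_) i <;> simp [quarterWeight, quarterCoeff]

theorem four_smul_quarterVector (f : Fin (m₁ + m₂) → E) :
    (4 : ℝ) • quarterVector f = ∑ k, (quarterWeight m₁ m₂ k : ℝ) • f k := by
  simp_rw [quarterVector, smul_smul, quarterWeight_cast]
  norm_num

theorem four_smul_watsonSystem (f : Fin (m₁ + m₂) → E) (p : Fin (m₁ + m₂)) :
    (4 : ℝ) • watsonSystem f p = ∑ k, (watsonMatrix m₁ m₂ p k : ℝ) • f k := by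
  rw [watsonSystem, smul_sub, four_smul_quarterVector]
  simp [watsonMatrix, sub_smul, Finset.sum_sub_distrib, ite_smul]

theorem four_smul_gluedSystem (f : Fin (4 + 3) → E) (p : Fin (4 + 3)) :
    (4 : ℝ) • gluedSystem f p = ∑ k, (gluedMatrix p k : ℝ) • f k := by
  have hq : quarterWeight 4 3 = ![1, 1, 1, 1, 2, 2, 2] := by decide
  have hg := four_smul_quarterVector f
  rw [hq, show ∀ F : Fin (4 + 3) → E, ∑ k, F k = _ from Fin.sum_univ_seven] at hg
  simp at hg
  fin_cases p <;> simp [gluedSystem, gluedMatrix, Fin.sum_univ_seven, smul_sub, hg] <;> module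

/-- A relation whose matrix is in the standard form `G` is, up to numbering, signs and a common factor,
the relation given by the system `S f` with matrix `G`; a lattice vector `quarterVector f` then
generates the lattice of the relation together with the `e_i`, having order `4` in the quotient. -/
theorem exists_sameSystem {e e' f f' : Fin n → E} {lam lam' : Fin n → ℝ} {Z : Fin n → Fin n → ℤ}
    (hfe : ∀ i, f i = e i ∨ f i = -e i) (hfe' : ∀ j, f' j = e' j ∨ f' j = -e' j)
    (hind : LinearIndependent ℝ f) (hZ : ∀ j, (4 : ℝ) • f' j = ∑ i, (Z j i : ℝ) • f i)
    (hcard : Nat.card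
      (latticeOfPair e e' ⧸ (latticeOf e).submoduleOf (latticeOfPair e e')) = 4)
    {q : Fin (m₁ + m₂) → ℤ} {G : Fin (m₁ + m₂) → Fin (m₁ + m₂) → ℤ}
    {S : (Fin (m₁ + m₂) → E) → Fin (m₁ + m₂) → E}
    (hS : ∀ f p, (4 : ℝ) • S f p = ∑ k, (G p k : ℝ) • f k)
    (hSw : ∀ f, quarterVector f ∈ latticeOf f ⊔ latticeOf (S f))
    (σ : Fin (m₁ + m₂) ≃ Fin n) {i₀ : Fin (m₁ + m₂)} (hi₀ : quarterWeight m₁ m₂ i₀ = 1)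
    (hstd : IsStandardForm q G (fun j i => Z j (σ i)) (fun i => lam (σ i)) lam') :
    ∃ (F : Fin (m₁ + m₂) → E) (c : ℝ), 0 < c ∧ SameSystem c e lam F (fun i => q i) ∧
      SameSystem c e' lam' (S F) (fun i => q i) ∧
      latticeOfPair e e' = latticeOf e ⊔ Submodule.span ℤ {quarterVector F} := by
  obtain ⟨u, c, τ, hu, hc, hrow, hlam, hlam'⟩ := hstd
  dsimp only at hrow hlam
  set F : Fin (m₁ + m₂) → E := fun i => u i • f (σ i) with hF
  have hFe : ∀ i, F i = e (σ i) ∨ F i = -e (σ i) := by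
    intro i
    rcases hu i with h | h <;> rcases hfe (σ i) with h' | h' <;> simp [hF, h, h']
  have hFind : LinearIndependent ℝ F := by
    have := (hind.comp σ σ.injective).units_smul fun i => if u i = 1 then (1 : ℝˣ) else -1
    convert this using 1
    funext i
    rcases hu i with h | h <;> simp [hF, h]
  have hSF : ∀ p, S F p = e' (τ p) ∨ S F p = -e' (τ p) := by
    intro p
    have h1 : S F p = f' (τ p) ∨ S F p = -f' (τ p) := by
      have h2 : (4 : ℝ) • f' (τ p) = ∑ k, (Z (τ p) (σ k) : ℝ) • f (σ k) := by
        rw [hZ, σ.sum_comp fun i => (Z (τ p) i : ℝ) • f i]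
      refine (hrow p).imp (fun h => ?_) fun h => ?_ <;>
        refine smul_right_injective E (four_ne_zero' ℝ) ?_ <;> dsimp only
      · rw [h2, hS]
        refine Finset.sum_congr rfl fun k _ => ?_
        rw [h, show F k = u k • f (σ k) from rfl, ← Int.cast_smul_eq_zsmul ℝ, smul_smul]
        push_cast
        rw [mul_comm]
      · rw [smul_neg, h2, hS, ← Finset.sum_neg_distrib]
        refine Finset.sum_congr rfl fun k _ => ?_
        rw [h, show F k = u k • f (σ k) from rfl, ← Int.cast_smul_eq_zsmul ℝ, smul_smul, ← neg_smul]
        push_cast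
        rw [neg_neg, mul_comm]
    rcases h1 with h | h <;> rcases hfe' (τ p) with h' | h' <;> simp [h, h']
  refine ⟨F, c, hc, ⟨σ, fun i => ⟨hFe i, hlam i⟩⟩, ⟨τ, fun i => ⟨hSF i, hlam' i⟩⟩, ?_⟩
  have hlat := latticeOf_eq_of_equiv σ hFe
  have hwmem : quarterVector F ∈ latticeOfPair e e' := by
    rw [latticeOfPair, hlat, latticeOf_eq_of_equiv τ hSF]
    exact hSw F
  have hw2 : (2 : ℤ) • quarterVector F ∉ latticeOf e := by
    rw [hlat, mem_latticeOf_iff]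
    rintro ⟨z, hz⟩
    have h0 : ∑ k, ((quarterWeight m₁ m₂ k : ℝ) - 2 * z k) • F k = 0 := by
      simp_rw [sub_smul, Finset.sum_sub_distrib, ← four_smul_quarterVector, mul_smul,
        ← Finset.smul_sum, Int.cast_smul_eq_zsmul, hz]
      rw [← Int.cast_smul_eq_zsmul ℝ, smul_smul]
      norm_num
    have h1 := Fintype.linearIndependent_iff.1 hFind _ h0 i₀
    rw [hi₀] at h1
    have h2 : ((1 - 2 * z i₀ : ℤ) : ℝ) = 0 := by push_cast at h1 ⊢; exact h1
    have := Int.cast_eq_zero.1 h2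
    omega
  refine le_antisymm (fun y hy => ?_) (sup_le le_sup_left ?_)
  · obtain ⟨k, hk⟩ := exists_sub_smul_mem hcard hwmem hw2 hy
    exact Submodule.mem_sup.2 ⟨_, hk, _, Submodule.smul_mem _ k (Submodule.mem_span_singleton_self _),
      sub_add_cancel _ _⟩
  · rw [Submodule.span_singleton_le_iff_mem]
    exact hwmem

theorem quarterVector_mem_watson (f : Fin (m₁ + m₂) → E) (i : Fin (m₁ + m₂)) :
    quarterVector f ∈ latticeOf f ⊔ latticeOf (watsonSystem f) :=
  Submodule.mem_sup.2 ⟨f i, Submodule.subset_span ⟨i, rfl⟩, watsonSystem f i,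
    Submodule.subset_span ⟨i, rfl⟩, by simp [watsonSystem]⟩

theorem quarterVector_mem_glued (f : Fin (4 + 3) → E) :
    quarterVector f ∈ latticeOf f ⊔ latticeOf (gluedSystem f) :=
  (le_sup_right : latticeOf (gluedSystem f) ≤ _) (Submodule.subset_span ⟨0, rfl⟩)

end Vectors

theorem mainTheorem3 {E : Type*} [NormedAddCommGroup E] [InnerProductSpace ℝ E]
    [FiniteDimensional ℝ E] (n : ℕ) (hn : Module.finrank ℝ E = n)
    (L : Submodule ℤ E) (hL : DiscreteTopology L)
    (e e' : Fin n → E) (lam lam' : Fin n → ℝ)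
    (hmin : ∀ i, IsMinimalVector L (e i)) (hmin' : ∀ i, IsMinimalVector L (e' i))
    (hrel : IsPerfectionRelation e e' lam lam')
    (hcyc : IsAddCyclic
      (latticeOfPair e e' ⧸ (latticeOf e).submoduleOf (latticeOfPair e e')))
    (hcard : Nat.card
      (latticeOfPair e e' ⧸ (latticeOf e).submoduleOf (latticeOfPair e e')) = 4) :
    (n = 7 ∧ IsGluedRelation e e' lam lam') ∨
    (n = 7 ∧ IsWatsonRelation 6 1 e e' lam lam') ∨
    (n = 8 ∧ IsWatsonRelation 8 0 e e' lam lam') := by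
  obtain ⟨f, f', r, Z, hfe, hfe', hind, hZ, ⟨i₁, hi₁⟩, h⟩ :=
    exists_isQuarterRelation hmin hmin' hrel hcyc hcard
  have hfL : ∀ i, f i ∈ L := fun i => by
    rcases hfe i with h | h <;> rw [h]
    · exact (hmin i).1
    · exact L.neg_mem (hmin i).1
  have hfL' : ∀ j, f' j ∈ L := fun j => by
    rcases hfe' j with h | h <;> rw [h]
    · exact (hmin' j).1
    · exact L.neg_mem (hmin' j).1
  -- A row congruent to `r` gives the lattice vector `(1/4) ∑ r_i f_i`.
  obtain ⟨w, hwL, hw⟩ : ∃ w ∈ L, (4 : ℝ) • w = ∑ i, (r i : ℝ) • f i := by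
    obtain ⟨j, hj⟩ := h.exists_row
    choose t ht using fun i => (hj i).dvd
    refine ⟨f' j + ∑ i, t i • f i, L.add_mem (hfL' j) (L.sum_mem fun i _ => L.smul_mem _ (hfL i)), ?_⟩
    rw [smul_add, hZ, Finset.smul_sum, ← Finset.sum_add_distrib]
    refine Finset.sum_congr rfl fun i _ => ?_
    rw [← Int.cast_smul_eq_zsmul ℝ, smul_smul, ← add_smul]
    have : r i = Z j i + 4 * t i := by linarith [ht i]
    rw [this]
    push_cast
    rfl
  obtain ⟨h4, h8, h42⟩ := quarter_types hind (norm_pos_iff.2 (hmin i₁).2.1) hfL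
    (fun i => (norm_eq_of_eq_or_eq_neg (hfe i)).trans ((hmin i).norm_eq (hmin i₁)))
    (fun y hy hy0 => (hmin i₁).2.2 y hy hy0) h.coeff ⟨i₁, hi₁⟩ hwL hw
  -- The coefficients are nonzero as soon as the corresponding columns of `Z` vanish.
  have hr12 : (∀ i, r i = 0 → ∀ j, Z j i = 0) → ∀ i, r i = 1 ∨ r i = 2 := fun h0 i =>
    (h.coeff i).resolve_left fun hi => by
      obtain ⟨j, hj⟩ := h.exists_ne_zero i
      exact hj (h0 i hi j)
  by_cases hm₁ : (Finset.univ.filter (r · = 1)).card = 4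
  · left
    obtain ⟨h3, hrow⟩ := h.four_three hm₁ (by omega)
    obtain ⟨σ, hσ⟩ := exists_equiv_append (hr12 fun i hi j => (hrow j).elim (fun hj => hj.2.2 i hi)
      fun hj => hj.2 i (by rw [hi]; norm_num)) hm₁ h3
    have hn7 : n = 7 := by simpa using (Fintype.card_congr σ).symm
    refine ⟨hn7, ?_⟩
    have h' := h.reindex σ
    change (fun i => r (σ i)) = quarterWeight 4 3 at hσ
    rw [hσ] at h'
    have hq1 : ∀ i, i < 4 → r (σ i) = 1 := fun i hi => by
      rw [congrFun hσ i]; revert i; decide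
    have hq2 : ∀ i, 4 ≤ i → r (σ i) = 2 := fun i hi => by
      rw [congrFun hσ i]; revert i; decide
    have hstd := h'.glued_four_three (by simp [hn7]) fun j => (hrow j).imp
      (fun hj => ⟨fun i hi => hj.1 _ (hq1 i hi), fun i hi => hj.2.1 _ (hq2 i hi)⟩)
      fun hj => ⟨fun i hi => hj.1 _ (hq1 i hi), fun i hi => hj.2 _ (by rw [hq2 i hi]; norm_num)⟩
    simpa [IsGluedRelation] using exists_sameSystem hfe hfe' hind hZ hcard four_smul_gluedSystem
      quarterVector_mem_glued σ (i₀ := 0) (by decide) hstd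
  right
  by_cases h61 : (Finset.univ.filter (r · = 1)).card = 6 ∧ (Finset.univ.filter (r · = 2)).card = 1
  · left
    have hrow := h.six_one h61.1 h61.2
    obtain ⟨σ, hσ⟩ := exists_equiv_append (hr12 fun i hi j => (hrow j).2.2 i hi) h61.1 h61.2
    have hn7 : n = 7 := by simpa using (Fintype.card_congr σ).symm
    refine ⟨hn7, ?_⟩
    have h' := h.reindex σ
    change (fun i => r (σ i)) = quarterWeight 6 1 at hσ
    rw [hσ] at h'
    have hq : ∀ i, i ≠ 6 → quarterWeight 6 1 i = 1 := by decide
    have hq1 : ∀ i, i ≠ 6 → r (σ i) = 1 := fun i hi => (congrFun hσ i).trans (hq i hi)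
    have hq6 : r (σ 6) = 2 := (congrFun hσ 6).trans (by decide)
    have hstd := h'.watson_six_one (by simp [hn7]) fun j => by
      refine Exists.imp (fun p hp => ⟨hp, (hrow j).2.1 _ hq6⟩) ?_
      rcases (hrow j).1 with hj | ⟨p, hp1, hp, hj⟩
      · refine ⟨6, fun k hk => ?_⟩
        rw [hj _ (hq1 k hk), watsonMatrix, hq k hk, if_neg hk, sub_zero]
      · refine ⟨σ.symm p, fun k hk => ?_⟩
        rw [watsonMatrix, hq k hk]
        split_ifs with hkp
        · rw [hkp, σ.apply_symm_apply, hp]; norm_num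
        · rw [hj _ (hq1 k hk) fun hk' => hkp (by rw [← hk', σ.symm_apply_apply]), sub_zero]
    simpa only [IsWatsonRelation, quarterWeight_cast] using exists_sameSystem hfe hfe' hind hZ hcard
      four_smul_watsonSystem (fun f => quarterVector_mem_watson f 0) σ (i₀ := 0) (by decide) hstd
  · right
    obtain ⟨hm8, hm0, hrow⟩ := h.eight_zero (by omega) h8 h61
    obtain ⟨σ, hσ⟩ := exists_equiv_append (hr12 fun i hi j => (hrow j).2 i hi) hm8 hm0
    have hn8 : n = 8 := by simpa using (Fintype.card_congr σ).symm
    refine ⟨hn8, ?_⟩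
    have h' := h.reindex σ
    change (fun i => r (σ i)) = quarterWeight 8 0 at hσ
    rw [hσ] at h'
    have hq : ∀ i, quarterWeight 8 0 i = 1 := by decide
    have hq1 : ∀ i, r (σ i) = 1 := fun i => (congrFun hσ i).trans (hq i)
    have hstd := h'.watson_eight (by simp [hn8]) fun j => by
      obtain ⟨p, hp1, hp, hj⟩ := (hrow j).1
      refine ⟨σ.symm p, fun k => ?_⟩
      rw [watsonMatrix, hq k]
      split_ifs with hkp
      · rw [hkp, σ.apply_symm_apply, hp]; norm_num
      · rw [hj _ (hq1 k) fun hk' => hkp (by rw [← hk', σ.symm_apply_apply]), sub_zero]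
    simpa only [IsWatsonRelation, quarterWeight_cast] using exists_sameSystem hfe hfe' hind hZ hcard
      four_smul_watsonSystem (fun f => quarterVector_mem_watson f 0) σ (i₀ := 0) (by decide) hstd
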